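/- **Setting.** A mosaic tile is a unit square carrying one of the following pictures, whose strands end at midpoints of sides: type I (blank); type II (one arc joining two adjacent sides: IIa left–bottom, IIb bottom–right, IIc right–top, IId left–top); type III (one segment: IIIa horizontal, IIIb vertical); type IV (two disjoint arcs: IVa = IIa together with IIc, IVb = IIb together with IId); type V (a crossing of a horizontal and a vertical strand: Va, Vb according to which strand is over). An $n$-mosaic is an $n\times n$ matrix of tiles (rows counted from the bottom, columns from the left). It is suitably connected if every strand end is met by a strand end of the neighbouring tile, so that the mosaic is the projection of a link in $\mathbb R^3$; it is a knot mosaic if this link has exactly one component. A suitably connected mosaic is a mosaic for a knot $K$ if its link is isotopic to $K$ (as unoriented polygonal links in $\mathbb R^3$, i.e. related by finitely many triangle moves and their inverses). Let $S$ be the square formed by the $(n-2)^2$ tiles not touching the boundary of the board. A *dual* $D$ of a mosaic $M_n$ is obtained by replacing each tile of $S$ as follows: V by I, IV by type 0 (a square with a dot and no arcs), IIIa and IIIb by each other, IIa and IIc by each other, IIb and IId by each other, and I by IVa or IVb (free choice at each such tile). The arcs of $D$ form disjoint loops in the interior of $S$ and *edges*, i.e. arcs with both endpoints on $\partial S$.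 An edge is an *XX-edge* if its endpoints are on the same side of $S$, and an *XY-edge* if they are on adjacent sides of $S$. Let $|D|$ be the number of non-blank tiles of $D$ (tiles not of type I), $|D'|$ the number of those that are not of type 0, $|D''|$ the number of tiles of type IV, and $T=(|D|,|D'|,|D''|)$. For a knot mosaic $M_n$ of a knot $K$ with dual $D$, *$T$ is minimal* if it is lexicographically least among the triples of all duals of all $n$-mosaics for $K$. An edge lies *outside* an XY-edge $e$ if it lies in the disk that $e$ cuts off from $S$ around the corner common to the two sides of $S$ containing the endpoints of $e$. An *XX-through-XY move is possible* in $D$ if some XY-edge shares a type IV tile with an XX-edge lying outside it. $D$ is a *minimal dual* if $T$ is minimal, $D$ contains no loops, and no XX-through-XY move is possible in $D$. **Theorem.** Let $M_n$ be a knot $n$-mosaic with a minimal dual $D$ such that $|D|\le n-4$. Then $D$ contains no XX-edges, and $D$ contains no XY-edges. -/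

import Mathlib

namespace KnotMosaic

/-! Cells of the square grid are indexed by `(i, j) : ℤ × ℤ`, where `i` is the row, counted from the
bottom, and `j` is the column, counted from the left.  An `n`-mosaic occupies `1 ≤ i, j ≤ n`. -/

/-- The four sides of a square: of a tile, or of the interior board `S`. -/
inductive Side
  | left | right | bottom | top
  deriving DecidableEq

/-- The opposite side. -/
def Side.opp : Side → Side
  | .left => .right
  | .right => .left
  | .bottom => .top
  | .top => .bottom

/-- Two sides of a square are adjacent if they share a corner. -/
def Side.Adjacent (X Y : Side) : Prop := Y ≠ X ∧ Y ≠ X.opp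

/-- The eleven mosaic tiles. -/
inductive Tile
  | I | IIa | IIb | IIc | IId | IIIa | IIIb | IVa | IVb | Va | Vb
  deriving DecidableEq

/-- The strands drawn on a tile, each given by the two sides whose midpoints it joins. -/
def Tile.strands : Tile → List (Side × Side)
  | .I => []
  | .IIa => [(.left, .bottom)]
  | .IIb => [(.bottom, .right)]
  | .IIc => [(.right, .top)]
  | .IId => [(.left, .top)]
  | .IIIa => [(.left, .right)]
  | .IIIb => [(.bottom, .top)]
  | .IVa => [(.left, .bottom), (.right, .top)]
  | .IVb => [(.bottom, .right), (.left, .top)]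
  | .Va => [(.left, .right), (.bottom, .top)]
  | .Vb => [(.left, .right), (.bottom, .top)]

/-- A strand of a crossing tile is the over-strand: the horizontal one on `Va`, the vertical one
on `Vb`. -/
def Tile.IsOver (t : Tile) (a : Side × Side) : Prop :=
  (t = .Va ∧ a = (.left, .right)) ∨ (t = .Vb ∧ a = (.bottom, .top))

/-- The tile has a strand ending at the midpoint of the side `s`. -/
def Tile.Uses (t : Tile) (s : Side) : Prop := ∃ a ∈ t.strands, a.1 = s ∨ a.2 = s

/-- An `n`-mosaic: an `n × n` matrix of tiles, extended by blank tiles outside the board. -/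
structure Mosaic (n : ℕ) where
  tile : ℤ → ℤ → Tile
  blank_outside : ∀ i j : ℤ, ¬ ((1 ≤ i ∧ i ≤ n) ∧ (1 ≤ j ∧ j ≤ n)) → tile i j = .I

/-- Suitably connected: every strand end lying on a side of a tile is met by a strand end of the
neighbouring tile (in particular no strand ends on the boundary of the board). -/
def Mosaic.SuitablyConnected {n : ℕ} (M : Mosaic n) : Prop :=
  ∀ i j : ℤ, ((M.tile i j).Uses .right ↔ (M.tile i (j + 1)).Uses .left) ∧
    ((M.tile i j).Uses .top ↔ (M.tile (i + 1) j).Uses .bottom)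

/-- The midpoint of a side of the cell `(i, j)`, as `(x, y)`, in coordinates in which this cell is the
square of side length `2` with centre `(2 * j, 2 * i)`. -/
def sidePt (i j : ℤ) : Side → ℤ × ℤ
  | .left => (2 * j - 1, 2 * i)
  | .right => (2 * j + 1, 2 * i)
  | .bottom => (2 * j, 2 * i - 1)
  | .top => (2 * j, 2 * i + 1)

/-- The point of `ℝ³` at height `h` above a point of the plane. -/
def lift (p : ℤ × ℤ) (h : ℝ) : Fin 3 → ℝ := ![(p.1 : ℝ), (p.2 : ℝ), h]

open Classical in
/-- The polygonal arc in `ℝ³` of a strand `a` of a tile `t` placed on the cell `(i, j)`: an over-strand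
is lifted to height `1` above the centre of the cell, every other strand is a straight segment at
height `0`. -/
noncomputable def strandSet (i j : ℤ) (t : Tile) (a : Side × Side) : Set (Fin 3 → ℝ) :=
  if t.IsOver a then
    segment ℝ (lift (sidePt i j a.1) 0) (lift (2 * j, 2 * i) 1) ∪
      segment ℝ (lift (2 * j, 2 * i) 1) (lift (sidePt i j a.2) 0)
  else segment ℝ (lift (sidePt i j a.1) 0) (lift (sidePt i j a.2) 0)

/-- The polygonal link in `ℝ³` whose projection is the picture drawn on the mosaic. -/
def Mosaic.link {n : ℕ} (M : Mosaic n) : Set (Fin 3 → ℝ) :=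
  {x | ∃ i j : ℤ, ∃ a ∈ (M.tile i j).strands, x ∈ strandSet i j (M.tile i j) a}

/-- A knot mosaic: a link mosaic (a suitably connected mosaic) whose link has exactly one
component. -/
def Mosaic.IsKnotMosaic {n : ℕ} (M : Mosaic n) : Prop :=
  M.SuitablyConnected ∧ IsConnected M.link

/-- An elementary deformation (triangle move) of polygonal links: a straight piece `[a, b]` of `K` is
replaced by `[a, c] ∪ [c, b]`, where `a b c` is a nondegenerate triangle that meets `K` only
in `[a, b]`. -/
def ElementaryDeformation (K K' : Set (Fin 3 → ℝ)) : Prop :=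
  ∃ a b c : Fin 3 → ℝ, AffineIndependent ℝ ![a, b, c] ∧
    convexHull ℝ {a, b, c} ∩ K = segment ℝ a b ∧
    K' = (K \ segment ℝ a b) ∪ (segment ℝ a c ∪ segment ℝ c b)

/-- Equivalence (isotopy) of polygonal knots and links in `ℝ³`: a finite sequence of elementary
deformations and their inverses. -/
def KnotEquiv : Set (Fin 3 → ℝ) → Set (Fin 3 → ℝ) → Prop :=
  Relation.EqvGen ElementaryDeformation

/-- `M` is a mosaic for the knot (or link) `K`. -/
def Mosaic.Represents {n : ℕ} (M : Mosaic n) (K : Set (Fin 3 → ℝ)) : Prop :=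
  M.SuitablyConnected ∧ KnotEquiv M.link K

/-- The cells of the interior `S` of an `n`-mosaic. -/
noncomputable def interior (n : ℕ) : Finset (ℤ × ℤ) :=
  Finset.Icc (2 : ℤ) ((n : ℤ) - 1) ×ˢ Finset.Icc (2 : ℤ) ((n : ℤ) - 1)

/-- The tiles that occur in a dual; `O` is the tile of type 0 (a square with a dot). -/
inductive DualTile
  | O | I | IIa | IIb | IIc | IId | IIIa | IIIb | IVa | IVb
  deriving DecidableEq

/-- The arcs drawn on a dual tile. -/
def DualTile.arcs : DualTile → List (Side × Side)
  | .O => []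
  | .I => []
  | .IIa => [(.left, .bottom)]
  | .IIb => [(.bottom, .right)]
  | .IIc => [(.right, .top)]
  | .IId => [(.left, .top)]
  | .IIIa => [(.left, .right)]
  | .IIIb => [(.bottom, .top)]
  | .IVa => [(.left, .bottom), (.right, .top)]
  | .IVb => [(.bottom, .right), (.left, .top)]

/-- The dual tile is of type IV. -/
def DualTile.IsIV (t : DualTile) : Prop := t = .IVa ∨ t = .IVb

instance (t : DualTile) : Decidable t.IsIV := by unfold DualTile.IsIV; infer_instance

/-- The replacement rule: `TileDual R T` says that the mosaic tile `R` may be replaced by the dual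
tile `T`. -/
inductive TileDual : Tile → DualTile → Prop
  | Va : TileDual .Va .I
  | Vb : TileDual .Vb .I
  | IVa : TileDual .IVa .O
  | IVb : TileDual .IVb .O
  | IIIa : TileDual .IIIa .IIIb
  | IIIb : TileDual .IIIb .IIIa
  | IIa : TileDual .IIa .IIc
  | IIb : TileDual .IIb .IId
  | IIc : TileDual .IIc .IIa
  | IId : TileDual .IId .IIb
  | Ia : TileDual .I .IVa
  | Ib : TileDual .I .IVb

/-- An array of dual tiles; a dual of a mosaic is blank outside `S`. -/
abbrev DualArray := ℤ → ℤ → DualTile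

/-- `D` is a dual of the mosaic `M`. -/
def IsDual {n : ℕ} (M : Mosaic n) (D : DualArray) : Prop :=
  ∀ i j : ℤ, ((i, j) ∈ interior n → TileDual (M.tile i j) (D i j)) ∧
    ((i, j) ∉ interior n → D i j = .I)

/-- `|D|`: the number of non-blank tiles of `D`. -/
noncomputable def DualArray.size (n : ℕ) (D : DualArray) : ℕ :=
  {c ∈ interior n | D c.1 c.2 ≠ .I}.card

/-- `|D'|`: the number of non-blank tiles of `D` that are not of type 0. -/
noncomputable def DualArray.size' (n : ℕ) (D : DualArray) : ℕ :=
  {c ∈ interior n | D c.1 c.2 ≠ .I ∧ D c.1 c.2 ≠ .O}.card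

/-- `|D''|`: the number of tiles of `D` of type IV. -/
noncomputable def DualArray.size'' (n : ℕ) (D : DualArray) : ℕ :=
  {c ∈ interior n | (D c.1 c.2).IsIV}.card

/-- The triple `T = (|D|, |D'|, |D''|)`, ordered lexicographically. -/
noncomputable def DualArray.triple (n : ℕ) (D : DualArray) : ℕ ×ₗ (ℕ ×ₗ ℕ) :=
  toLex (D.size n, toLex (D.size' n, D.size'' n))

/-- `T` is minimal: among all duals of all `n`-mosaics for the knot given by `M`, the triple of `D` is
least. -/
def TMinimal {n : ℕ} (M : Mosaic n) (D : DualArray) : Prop :=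
  ∀ (M' : Mosaic n) (D' : DualArray), M'.Represents M.link → IsDual M' D' →
    D.triple n ≤ D'.triple n

/-- Two midpoints of sides of a cell are joined by an arc of the dual inside that cell. -/
def DualArray.Joins (D : DualArray) (p q : ℤ × ℤ) : Prop :=
  ∃ i j : ℤ, ∃ a ∈ (D i j).arcs, p = sidePt i j a.1 ∧ q = sidePt i j a.2

/-- Two points lie on the same component (loop or edge) of the curve system drawn by the dual. -/
def DualArray.SameComponent (D : DualArray) : ℤ × ℤ → ℤ × ℤ → Prop :=
  Relation.EqvGen D.Joins

/-- The point is the midpoint of the side `X` of some cell of `S`, and lies on the side `X` of the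
square `S`. -/
def OnSide (n : ℕ) : Side → ℤ × ℤ → Prop
  | .left, p => ∃ i : ℤ, (i, 2) ∈ interior n ∧ p = sidePt i 2 .left
  | .right, p => ∃ i : ℤ, (i, (n : ℤ) - 1) ∈ interior n ∧ p = sidePt i ((n : ℤ) - 1) .right
  | .bottom, p => ∃ j : ℤ, (2, j) ∈ interior n ∧ p = sidePt 2 j .bottom
  | .top, p => ∃ j : ℤ, ((n : ℤ) - 1, j) ∈ interior n ∧ p = sidePt ((n : ℤ) - 1) j .top

/-- The distance of a point of `S` from the side of `S` given by the first argument, up to an additive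
constant that depends only on that side. -/
def coordFrom : Side → ℤ × ℤ → ℤ
  | .left, p => p.1
  | .right, p => -p.1
  | .bottom, p => p.2
  | .top, p => -p.2

/-- `p` and `q` are the two endpoints of an edge of the dual: distinct points of `∂S` on the same
component. -/
def DualArray.IsEdge (D : DualArray) (n : ℕ) (p q : ℤ × ℤ) : Prop :=
  p ≠ q ∧ (∃ X, OnSide n X p) ∧ (∃ Y, OnSide n Y q) ∧ D.SameComponent p q

/-- The edge with endpoints `p`, `q` is an XX-edge: both endpoints are on the same side of `S`. -/
def DualArray.IsXXEdge (D : DualArray) (n : ℕ) (p q : ℤ × ℤ) : Prop :=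
  D.IsEdge n p q ∧ ∃ X, OnSide n X p ∧ OnSide n X q

/-- The edge with endpoints `p`, `q` is an XY-edge: its endpoints are on adjacent sides of `S`. -/
def DualArray.IsXYEdge (D : DualArray) (n : ℕ) (p q : ℤ × ℤ) : Prop :=
  D.IsEdge n p q ∧ ∃ X Y, X.Adjacent Y ∧ OnSide n X p ∧ OnSide n Y q

/-- The dual contains a loop: a component with at least one arc that does not meet `∂S`. -/
def DualArray.HasLoop (D : DualArray) (n : ℕ) : Prop :=
  ∃ p q, D.Joins p q ∧ ∀ r X, D.SameComponent p r → ¬ OnSide n X r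

/-- The component of `p` contains an arc in the cell `(i, j)`. -/
def DualArray.PassesThrough (D : DualArray) (p : ℤ × ℤ) (i j : ℤ) : Prop :=
  ∃ a ∈ (D i j).arcs, D.SameComponent p (sidePt i j a.1)

/-- The XX-edge with endpoints `u`, `v` is outside the XY-edge with endpoints `p`, `q`.  The outside of
an XY-edge is the disk that it cuts off around the corner of `S` common to its two sides `X`, `Y`.  As
distinct edges are disjoint, an XX-edge lies in this disk exactly when both of its endpoints lie on
`X` between `p` and that corner, or both lie on `Y` between `q` and that corner. -/
def OutsideXY (n : ℕ) (p q u v : ℤ × ℤ) : Prop :=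
  ∃ X Y : Side, X.Adjacent Y ∧ OnSide n X p ∧ OnSide n Y q ∧
    ((OnSide n X u ∧ OnSide n X v ∧ coordFrom Y u < coordFrom Y p ∧ coordFrom Y v < coordFrom Y p) ∨
     (OnSide n Y u ∧ OnSide n Y v ∧ coordFrom X u < coordFrom X q ∧ coordFrom X v < coordFrom X q))

/-- An XX-through-XY move is possible: some XY-edge has an XX-edge outside it with which it shares a
type IV tile. -/
def DualArray.HasXXThroughXYMove (D : DualArray) (n : ℕ) : Prop :=
  ∃ p q u v : ℤ × ℤ, D.IsXYEdge n p q ∧ D.IsXXEdge n u v ∧ OutsideXY n p q u v ∧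
    ∃ i j : ℤ, (D i j).IsIV ∧ D.PassesThrough p i j ∧ D.PassesThrough u i j

/-- `M` with its dual `D` is a minimal embedding of the knot given by `M` (and `D` is a minimal dual):
`T` is minimal, `D` has no loops, and no XX-through-XY move is possible in `D`. -/
structure IsMinimalEmbedding {n : ℕ} (M : Mosaic n) (D : DualArray) : Prop where
  isKnotMosaic : M.IsKnotMosaic
  isDual : IsDual M D
  tMinimal : TMinimal M D
  no_loop : ¬ D.HasLoop n
  no_move : ¬ D.HasXXThroughXYMove n

end KnotMosaic

/-! Arcs of a dual end only at midpoints of cell sides that no strand of the mosaic crosses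
(`TileDual.uses_iff`); call such sides free. It therefore suffices that no cell side on ∂S is free:
the dual then has no edges at all (`IsMinimalEmbedding.not_isEdge`).

T depends on the mosaic alone. Give crossings rank 0, double arcs rank 1, single strands rank 2 and
blanks rank 3; the entries of T count the tiles of S of rank at least 1, 2 and 3
(`IsDual.triple_eq`). An isotopy that, after a rearrangement of cells of S, raises no rank in S and
lowers one contradicts minimality. Two such isotopies are built from explicit triangle moves. A
Reidemeister I kink turns an arc into a crossing (`IsCheapest.not_isKinkSite`). A strip shift moves
a vertical strand one column to the left, past horizontal strands; the full tiles and the horizontal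
segments of the middle rows trade columns, and the upper left tile gains an arc
(`IsCheapest.not_isStrip`).

At a vertex whose adjacent cells lie suitably in S, three free sides are impossible. If the fourth
side were crossed, a strip of two rows could be shifted. If all four were free, kinks would force
the surrounding tiles to be blank, freeness would spread from vertex to vertex, and the whole board
would be blank (`IsCheapest.not_openFace`).

Now let the side below S in column j be free and follow the arc of the dual upwards. If it turns
right, it is a bracket (`IsBracket`). When strands cross all corresponding sides in column j + 1,
they form the vertical part of a strip. Otherwise the highest free side there belongs to a bracket
in column j + 1 that ends lower. This pushes brackets to the right until column n - 1, where a strip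
using the boundary column, or a vertex with three free sides, finishes the argument
(`IsCheapest.not_isBracket`). By reflection the arc does not turn left either, so it runs straight
through S and |D| ≥ n - 2, against |D| ≤ n - 4. Reflections settle the other three sides of S. -/

namespace KnotMosaic

/-! ### Triangle moves in coordinates -/

/-- The point with coordinates `(a, b, c)` relative to the base point `(X, Y, 0)`. -/
def pt (X Y a b c : ℝ) : Fin 3 → ℝ := ![X + a, Y + b, c]

lemma pt_zero (X Y a b c : ℝ) : pt X Y a b c 0 = X + a := rfl
lemma pt_one (X Y a b c : ℝ) : pt X Y a b c 1 = Y + b := rfl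
lemma pt_two (X Y a b c : ℝ) : pt X Y a b c 2 = c := rfl

lemma eq_pt_iff {x : Fin 3 → ℝ} {X Y a b c : ℝ} :
    x = pt X Y a b c ↔ x 0 = X + a ∧ x 1 = Y + b ∧ x 2 = c := by
  constructor
  · rintro rfl; exact ⟨rfl, rfl, rfl⟩
  · rintro ⟨h0, h1, h2⟩
    funext k
    fin_cases k
    · exact h0
    · exact h1
    · exact h2

/-- The straight segment between two points given by coordinates relative to `(X, Y, 0)`. -/
def seg (X Y a b c a' b' c' : ℝ) : Set (Fin 3 → ℝ) := segment ℝ (pt X Y a b c) (pt X Y a' b' c')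

lemma mem_seg {x : Fin 3 → ℝ} {X Y a b c a' b' c' : ℝ} (h : x ∈ seg X Y a b c a' b' c') :
    ∃ s : ℝ, 0 ≤ s ∧ s ≤ 1 ∧ x 0 = X + (a + s * (a' - a)) ∧ x 1 = Y + (b + s * (b' - b)) ∧
      x 2 = c + s * (c' - c) := by
  obtain ⟨u, v, hu, hv, huv, rfl⟩ := h
  obtain rfl : u = 1 - v := by linarith
  refine ⟨v, hv, by linarith, ?_, ?_, ?_⟩ <;>
    simp only [Pi.add_apply, Pi.smul_apply, smul_eq_mul, pt_zero, pt_one, pt_two] <;> ring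

lemma seg_symm (X Y a b c a' b' c' : ℝ) : seg X Y a b c a' b' c' = seg X Y a' b' c' a b c :=
  segment_symm _ _ _

lemma mem_convexHull_triple {p q r x : Fin 3 → ℝ} (h : x ∈ convexHull ℝ {p, q, r}) :
    ∃ α β γ : ℝ, 0 ≤ α ∧ 0 ≤ β ∧ 0 ≤ γ ∧ α + β + γ = 1 ∧ x = α • p + β • q + γ • r := by
  rw [convexHull_insert (by simp), convexHull_pair, mem_convexJoin] at h
  obtain ⟨a, ha, b, ⟨u, v, hu, hv, huv, rfl⟩, s, t, hs, ht, hst, rfl⟩ := h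
  rw [Set.mem_singleton_iff] at ha
  subst ha
  refine ⟨s, t * u, t * v, hs, mul_nonneg ht hu, mul_nonneg ht hv, ?_, ?_⟩
  · rw [add_assoc, ← mul_add, huv, mul_one, hst]
  · rw [smul_add, smul_smul, smul_smul, add_assoc]

/-- The difference vectors of a collinear triple are proportional, so all their 2 × 2 minors vanish.
-/
lemma affineIndependent_of_minor_ne_zero {p q r : Fin 3 → ℝ} (k l : Fin 3)
    (h : (q k - p k) * (r l - p l) - (q l - p l) * (r k - p k) ≠ 0) :
    AffineIndependent ℝ ![p, q, r] := by
  rw [affineIndependent_iff_not_collinear_set]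
  intro hc
  rw [collinear_iff_of_mem (p₀ := p) (by simp)] at hc
  obtain ⟨v, hv⟩ := hc
  obtain ⟨s, rfl⟩ := hv q (by simp)
  obtain ⟨t, rfl⟩ := hv r (by simp)
  apply h
  simp only [vadd_eq_add, Pi.add_apply, Pi.smul_apply, smul_eq_mul]
  ring

lemma KnotEquiv.refl (K : Set (Fin 3 → ℝ)) : KnotEquiv K K := Relation.EqvGen.refl K

lemma KnotEquiv.symm {K L : Set (Fin 3 → ℝ)} (h : KnotEquiv K L) : KnotEquiv L K :=
  Relation.EqvGen.symm _ _ h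

lemma KnotEquiv.trans {K L N : Set (Fin 3 → ℝ)} (h : KnotEquiv K L) (h' : KnotEquiv L N) :
    KnotEquiv K N := Relation.EqvGen.trans _ _ _ h h'

/-- A triangle move in a link `C ∪ [p, q]` whose part `C` meets the triangle `p q r` at most in the
points `p` and `q`. -/
lemma knotEquiv_triangle {C : Set (Fin 3 → ℝ)} {X Y p₀ p₁ p₂ q₀ q₁ q₂ r₀ r₁ r₂ : ℝ}
    (hdeg : (q₀ - p₀) * (r₁ - p₁) - (q₁ - p₁) * (r₀ - p₀) ≠ 0 ∨
      (q₀ - p₀) * (r₂ - p₂) - (q₂ - p₂) * (r₀ - p₀) ≠ 0 ∨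
      (q₁ - p₁) * (r₂ - p₂) - (q₂ - p₂) * (r₁ - p₁) ≠ 0)
    (hC : ∀ x ∈ C, ∀ α β γ : ℝ, 0 ≤ α → 0 ≤ β → 0 ≤ γ → α + β + γ = 1 →
      x 0 = X + (α * p₀ + β * q₀ + γ * r₀) → x 1 = Y + (α * p₁ + β * q₁ + γ * r₁) →
      x 2 = α * p₂ + β * q₂ + γ * r₂ → β + γ ≤ 0 ∨ α + γ ≤ 0) :
    KnotEquiv (C ∪ seg X Y p₀ p₁ p₂ q₀ q₁ q₂)
      (C ∪ (seg X Y p₀ p₁ p₂ r₀ r₁ r₂ ∪ seg X Y r₀ r₁ r₂ q₀ q₁ q₂)) := by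
  -- In barycentric coordinates the alternatives in `hC` say that x is p (β = γ = 0) or q (α = γ =
  -- 0). Stating them as linear inequalities lets linear arithmetic verify each concrete move.
  have key : ∀ x ∈ C, x ∈ convexHull ℝ {pt X Y p₀ p₁ p₂, pt X Y q₀ q₁ q₂, pt X Y r₀ r₁ r₂} →
      x = pt X Y p₀ p₁ p₂ ∨ x = pt X Y q₀ q₁ q₂ := by
    intro x hx hx'
    obtain ⟨α, β, γ, hα, hβ, hγ, hs, rfl⟩ := mem_convexHull_triple hx'
    obtain rfl : α = 1 - β - γ := by linarith
    rcases hC _ hx (1 - β - γ) β γ hα hβ hγ hs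
      (by simp only [Pi.add_apply, Pi.smul_apply, smul_eq_mul, pt_zero]; ring)
      (by simp only [Pi.add_apply, Pi.smul_apply, smul_eq_mul, pt_one]; ring)
      (by simp only [Pi.add_apply, Pi.smul_apply, smul_eq_mul, pt_two]) with h | h
    · obtain rfl : β = 0 := by linarith
      obtain rfl : γ = 0 := by linarith
      left; simp
    · obtain rfl : γ = 0 := by linarith
      obtain rfl : β = 1 := by linarith
      right; simp
  refine Relation.EqvGen.rel _ _ ⟨pt X Y p₀ p₁ p₂, pt X Y q₀ q₁ q₂, pt X Y r₀ r₁ r₂, ?_, ?_, ?_⟩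
  · rcases hdeg with h | h | h
    · apply affineIndependent_of_minor_ne_zero 0 1
      simpa only [pt_zero, pt_one, pt_two, add_sub_add_left_eq_sub] using h
    · apply affineIndependent_of_minor_ne_zero 0 2
      simpa only [pt_zero, pt_one, pt_two, add_sub_add_left_eq_sub] using h
    · apply affineIndependent_of_minor_ne_zero 1 2
      simpa only [pt_zero, pt_one, pt_two, add_sub_add_left_eq_sub] using h
  · apply Set.Subset.antisymm
    · rintro x ⟨hx, hx' | hx'⟩
      · rcases key x hx' hx with rfl | rfl
        · exact left_mem_segment _ _ _
        · exact right_mem_segment _ _ _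
      · exact hx'
    · intro x hx
      refine ⟨?_, Or.inr hx⟩
      exact segment_subset_convexHull (by simp) (by simp) hx
  · ext x
    simp only [Set.mem_union, Set.mem_sdiff]
    constructor
    · rintro (hx | hx)
      · by_cases h : x ∈ segment ℝ (pt X Y p₀ p₁ p₂) (pt X Y q₀ q₁ q₂)
        · right
          rcases key x hx (segment_subset_convexHull (by simp) (by simp) h) with rfl | rfl
          · exact Or.inl (left_mem_segment _ _ _)
          · exact Or.inr (right_mem_segment _ _ _)
        · exact Or.inl ⟨Or.inl hx, h⟩
      · exact Or.inr hx
    · rintro (⟨hx | hx, h⟩ | hx)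
      · exact Or.inl hx
      · exact absurd hx h
      · exact Or.inr hx

end KnotMosaic

set_option linter.unusedTactic false
set_option linter.unreachableTactic false
namespace KnotMosaic

lemma KnotEquiv.of_eq {K L : Set (Fin 3 → ℝ)} (h : K = L) : KnotEquiv K L := h ▸ KnotEquiv.refl K

/-- `knotEquiv_triangle` with explicit arguments. -/
lemma triangle_move (C : Set (Fin 3 → ℝ)) (X Y p₀ p₁ p₂ q₀ q₁ q₂ r₀ r₁ r₂ : ℝ)
    (hdeg : (q₀ - p₀) * (r₁ - p₁) - (q₁ - p₁) * (r₀ - p₀) ≠ 0 ∨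
      (q₀ - p₀) * (r₂ - p₂) - (q₂ - p₂) * (r₀ - p₀) ≠ 0 ∨
      (q₁ - p₁) * (r₂ - p₂) - (q₂ - p₂) * (r₁ - p₁) ≠ 0)
    (hC : ∀ x ∈ C, ∀ α β γ : ℝ, 0 ≤ α → 0 ≤ β → 0 ≤ γ → α + β + γ = 1 →
      x 0 = X + (α * p₀ + β * q₀ + γ * r₀) → x 1 = Y + (α * p₁ + β * q₁ + γ * r₁) →
      x 2 = α * p₂ + β * q₂ + γ * r₂ → β + γ ≤ 0 ∨ α + γ ≤ 0) :
    KnotEquiv (C ∪ seg X Y p₀ p₁ p₂ q₀ q₁ q₂)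
      (C ∪ (seg X Y p₀ p₁ p₂ r₀ r₁ r₂ ∪ seg X Y r₀ r₁ r₂ q₀ q₁ q₂)) :=
  knotEquiv_triangle hdeg hC

/-- The strand `p r q` is moved to `p r' q` by an inverse triangle move followed by a triangle
move. -/
lemma quad_move (C : Set (Fin 3 → ℝ)) (X Y p₀ p₁ p₂ q₀ q₁ q₂ r₀ r₁ r₂ r₀' r₁' r₂' : ℝ)
    (hdeg : (q₀ - p₀) * (r₁ - p₁) - (q₁ - p₁) * (r₀ - p₀) ≠ 0 ∨
      (q₀ - p₀) * (r₂ - p₂) - (q₂ - p₂) * (r₀ - p₀) ≠ 0 ∨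
      (q₁ - p₁) * (r₂ - p₂) - (q₂ - p₂) * (r₁ - p₁) ≠ 0)
    (hdeg' : (q₀ - p₀) * (r₁' - p₁) - (q₁ - p₁) * (r₀' - p₀) ≠ 0 ∨
      (q₀ - p₀) * (r₂' - p₂) - (q₂ - p₂) * (r₀' - p₀) ≠ 0 ∨
      (q₁ - p₁) * (r₂' - p₂) - (q₂ - p₂) * (r₁' - p₁) ≠ 0)
    (hC : ∀ x ∈ C, ∀ α β γ : ℝ, 0 ≤ α → 0 ≤ β → 0 ≤ γ → α + β + γ = 1 →
      (x 0 = X + (α * p₀ + β * q₀ + γ * r₀) ∧ x 1 = Y + (α * p₁ + β * q₁ + γ * r₁) ∧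
        x 2 = α * p₂ + β * q₂ + γ * r₂) ∨
      (x 0 = X + (α * p₀ + β * q₀ + γ * r₀') ∧ x 1 = Y + (α * p₁ + β * q₁ + γ * r₁') ∧
        x 2 = α * p₂ + β * q₂ + γ * r₂') → β + γ ≤ 0 ∨ α + γ ≤ 0) :
    KnotEquiv (C ∪ (seg X Y p₀ p₁ p₂ r₀ r₁ r₂ ∪ seg X Y r₀ r₁ r₂ q₀ q₁ q₂))
      (C ∪ (seg X Y p₀ p₁ p₂ r₀' r₁' r₂' ∪ seg X Y r₀' r₁' r₂' q₀ q₁ q₂)) :=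
  (knotEquiv_triangle hdeg fun x hx α β γ hα hβ hγ hs h0 h1 h2 =>
    hC x hx α β γ hα hβ hγ hs (Or.inl ⟨h0, h1, h2⟩)).symm.trans
  (knotEquiv_triangle hdeg' fun x hx α β γ hα hβ hγ hs h0 h1 h2 =>
    hC x hx α β γ hα hβ hγ hs (Or.inr ⟨h0, h1, h2⟩))

/-! ### Local isotopies for strips and kinks -/

/-- Sliding a strand under a horizontal over-strand, from the column of `X + 2` to that of `X`. -/
lemma slide_under {C : Set (Fin 3 → ℝ)} {X Y : ℝ}
    (hC : ∀ x ∈ C, X - 1 ≤ x 0 → x 0 ≤ X + 3 → Y - 1 ≤ x 1 → x 1 ≤ Y + 1 →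
      (x 0 = X - 1 ∧ x 1 = Y) ∨ (x 0 = X + 3 ∧ x 1 = Y) ∨ (x 0 = X ∧ x 1 = Y + 1) ∨
        (x 0 = X + 2 ∧ x 1 = Y - 1)) :
    KnotEquiv (C ∪ (seg X Y 2 1 0 0 1 0 ∪ (seg X Y (-1) 0 0 1 0 0 ∪
        ((seg X Y 1 0 0 2 0 1 ∪ seg X Y 2 0 1 3 0 0) ∪ seg X Y 2 (-1) 0 2 1 0))))
      (C ∪ (seg X Y 2 (-1) 0 0 (-1) 0 ∪ (((seg X Y (-1) 0 0 0 0 1 ∪ seg X Y 0 0 1 1 0 0) ∪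
        seg X Y 0 (-1) 0 0 1 0) ∪ seg X Y 1 0 0 3 0 0))) := by
  -- The hump of the over-strand is widened to a plateau at height 1 above both columns, the
  -- vertical strand is swept below it, and the plateau is then lowered on the right.
  have h1 := quad_move (C ∪ (seg X Y 2 1 0 0 1 0 ∪ seg X Y 2 0 1 3 0 0 ∪ seg X Y 2 (-1) 0 2 1 0))
    X Y (-1) 0 0 2 0 1 1 0 0 0 0 1
    (by norm_num) (by norm_num) (by
      rintro x (hx | (hx | hx) | hx) α β γ hα hβ hγ hs (⟨h0, h1, h2⟩ | ⟨h0, h1, h2⟩)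
      iterate 2
        · rcases hC x hx (by linarith) (by linarith) (by linarith) (by linarith) with
            ⟨e0, e1⟩ | ⟨e0, e1⟩ | ⟨e0, e1⟩ | ⟨e0, e1⟩ <;> first | (left; linarith) | (right; linarith)
      all_goals
        obtain ⟨s, hs0, hs1, e0, e1, e2⟩ := mem_seg hx
        first | (left; linarith) | (right; linarith))
  have h3 := quad_move (C ∪ (seg X Y (-1) 0 0 0 0 1 ∪ seg X Y 0 0 1 2 0 1 ∪ seg X Y 2 0 1 3 0 0))
    X Y 2 (-1) 0 0 1 0 2 1 0 0 (-1) 0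
    (by norm_num) (by norm_num) (by
      rintro x (hx | (hx | hx) | hx) α β γ hα hβ hγ hs (⟨h0, h1, h2⟩ | ⟨h0, h1, h2⟩)
      iterate 2
        · rcases hC x hx (by linarith) (by linarith) (by linarith) (by linarith) with
            ⟨e0, e1⟩ | ⟨e0, e1⟩ | ⟨e0, e1⟩ | ⟨e0, e1⟩ <;> first | (left; linarith) | (right; linarith)
      all_goals
        obtain ⟨s, hs0, hs1, e0, e1, e2⟩ := mem_seg hx
        first | (left; linarith) | (right; linarith))
  have h5 := quad_move (C ∪ (seg X Y (-1) 0 0 0 0 1 ∪ seg X Y 2 (-1) 0 0 (-1) 0 ∪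
      seg X Y 0 (-1) 0 0 1 0)) X Y 0 0 1 3 0 0 2 0 1 1 0 0
    (by norm_num) (by norm_num) (by
      rintro x (hx | (hx | hx) | hx) α β γ hα hβ hγ hs (⟨h0, h1, h2⟩ | ⟨h0, h1, h2⟩)
      iterate 2
        · rcases hC x hx (by linarith) (by linarith) (by linarith) (by linarith) with
            ⟨e0, e1⟩ | ⟨e0, e1⟩ | ⟨e0, e1⟩ | ⟨e0, e1⟩ <;> first | (left; linarith) | (right; linarith)
      all_goals
        obtain ⟨s, hs0, hs1, e0, e1, e2⟩ := mem_seg hx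
        first | (left; linarith) | (right; linarith))
  exact (KnotEquiv.of_eq (by ac_rfl)).trans <| h1.trans <|
    (KnotEquiv.of_eq (by ac_rfl)).trans <| h3.trans <|
    (KnotEquiv.of_eq (by ac_rfl)).trans <| h5.trans <|
    KnotEquiv.of_eq (by ac_rfl)

/-- Sliding an over-strand over a horizontal strand, from the column of `X + 2` to that of `X`. -/
lemma slide_over {C : Set (Fin 3 → ℝ)} {X Y : ℝ}
    (hC : ∀ x ∈ C, X - 1 ≤ x 0 → x 0 ≤ X + 3 → Y - 1 ≤ x 1 → x 1 ≤ Y + 1 →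
      (x 0 = X - 1 ∧ x 1 = Y) ∨ (x 0 = X + 3 ∧ x 1 = Y) ∨ (x 0 = X ∧ x 1 = Y + 1) ∨
        (x 0 = X + 2 ∧ x 1 = Y - 1)) :
    KnotEquiv (C ∪ (seg X Y 2 1 0 0 1 0 ∪ (seg X Y (-1) 0 0 1 0 0 ∪
        (seg X Y 1 0 0 3 0 0 ∪ (seg X Y 2 (-1) 0 2 0 1 ∪ seg X Y 2 0 1 2 1 0)))))
      (C ∪ (seg X Y 2 (-1) 0 0 (-1) 0 ∪ ((seg X Y (-1) 0 0 1 0 0 ∪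
        (seg X Y 0 (-1) 0 0 0 1 ∪ seg X Y 0 0 1 0 1 0)) ∪ seg X Y 1 0 0 3 0 0))) := by
  -- The upper half of the over-strand is moved first, creating a bridge at height 1 between the two
  -- columns; the lower half follows.
  have h1 := quad_move (C ∪ (seg X Y (-1) 0 0 1 0 0 ∪ seg X Y 1 0 0 3 0 0 ∪
      seg X Y 2 (-1) 0 2 0 1)) X Y 2 0 1 0 1 0 2 1 0 0 0 1
    (by norm_num) (by norm_num) (by
      rintro x (hx | (hx | hx) | hx) α β γ hα hβ hγ hs (⟨h0, h1, h2⟩ | ⟨h0, h1, h2⟩)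
      iterate 2
        · rcases hC x hx (by linarith) (by linarith) (by linarith) (by linarith) with
            ⟨e0, e1⟩ | ⟨e0, e1⟩ | ⟨e0, e1⟩ | ⟨e0, e1⟩ <;> first | (left; linarith) | (right; linarith)
      all_goals
        obtain ⟨s, hs0, hs1, e0, e1, e2⟩ := mem_seg hx
        first | (left; linarith) | (right; linarith))
  have h3 := quad_move (C ∪ (seg X Y (-1) 0 0 1 0 0 ∪ seg X Y 1 0 0 3 0 0 ∪
      seg X Y 0 0 1 0 1 0)) X Y 2 (-1) 0 0 0 1 2 0 1 0 (-1) 0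
    (by norm_num) (by norm_num) (by
      rintro x (hx | (hx | hx) | hx) α β γ hα hβ hγ hs (⟨h0, h1, h2⟩ | ⟨h0, h1, h2⟩)
      iterate 2
        · rcases hC x hx (by linarith) (by linarith) (by linarith) (by linarith) with
            ⟨e0, e1⟩ | ⟨e0, e1⟩ | ⟨e0, e1⟩ | ⟨e0, e1⟩ <;> first | (left; linarith) | (right; linarith)
      all_goals
        obtain ⟨s, hs0, hs1, e0, e1, e2⟩ := mem_seg hx
        first | (left; linarith) | (right; linarith))
  exact (KnotEquiv.of_eq (by ac_rfl)).trans <| h1.trans <|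
    (KnotEquiv.of_eq (by ac_rfl)).trans <| h3.trans <|
    KnotEquiv.of_eq (by ac_rfl)

/-- Sliding a tile with arcs left-bottom and right-top, from the column of `X + 2` to that of `X`. -/
lemma slide_IVa {C : Set (Fin 3 → ℝ)} {X Y : ℝ}
    (hC : ∀ x ∈ C, X - 1 ≤ x 0 → x 0 ≤ X + 3 → Y - 1 ≤ x 1 → x 1 ≤ Y + 1 →
      (x 0 = X - 1 ∧ x 1 = Y) ∨ (x 0 = X + 3 ∧ x 1 = Y) ∨ (x 0 = X ∧ x 1 = Y + 1) ∨
        (x 0 = X + 2 ∧ x 1 = Y - 1)) :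
    KnotEquiv (C ∪ (seg X Y 2 1 0 0 1 0 ∪ (seg X Y (-1) 0 0 1 0 0 ∪
        (seg X Y 1 0 0 2 (-1) 0 ∪ seg X Y 3 0 0 2 1 0))))
      (C ∪ (seg X Y 2 (-1) 0 0 (-1) 0 ∪ ((seg X Y (-1) 0 0 0 (-1) 0 ∪ seg X Y 1 0 0 0 1 0) ∪
        seg X Y 1 0 0 3 0 0))) := by
  rw [seg_symm X Y 2 (-1) 0 0 (-1) 0, seg_symm X Y 1 0 0 3 0 0]
  have h1 := quad_move (C ∪ (seg X Y 2 1 0 0 1 0 ∪ seg X Y 3 0 0 2 1 0))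
    X Y (-1) 0 0 2 (-1) 0 1 0 0 0 (-1) 0
    (by norm_num) (by norm_num) (by
      rintro x (hx | hx | hx) α β γ hα hβ hγ hs (⟨h0, h1, h2⟩ | ⟨h0, h1, h2⟩)
      iterate 2
        · rcases hC x hx (by linarith) (by linarith) (by linarith) (by linarith) with
            ⟨e0, e1⟩ | ⟨e0, e1⟩ | ⟨e0, e1⟩ | ⟨e0, e1⟩ <;> first | (left; linarith) | (right; linarith)
      all_goals
        obtain ⟨s, hs0, hs1, e0, e1, e2⟩ := mem_seg hx
        first | (left; linarith) | (right; linarith))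
  have h3 := quad_move (C ∪ (seg X Y (-1) 0 0 0 (-1) 0 ∪ seg X Y 0 (-1) 0 2 (-1) 0))
    X Y 3 0 0 0 1 0 2 1 0 1 0 0
    (by norm_num) (by norm_num) (by
      rintro x (hx | hx | hx) α β γ hα hβ hγ hs (⟨h0, h1, h2⟩ | ⟨h0, h1, h2⟩)
      iterate 2
        · rcases hC x hx (by linarith) (by linarith) (by linarith) (by linarith) with
            ⟨e0, e1⟩ | ⟨e0, e1⟩ | ⟨e0, e1⟩ | ⟨e0, e1⟩ <;> first | (left; linarith) | (right; linarith)
      all_goals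
        obtain ⟨s, hs0, hs1, e0, e1, e2⟩ := mem_seg hx
        first | (left; linarith) | (right; linarith))
  exact (KnotEquiv.of_eq (by ac_rfl)).trans <| h1.trans <|
    (KnotEquiv.of_eq (by ac_rfl)).trans <| h3.trans <|
    KnotEquiv.of_eq (by ac_rfl)

/-- Sliding a tile with arcs bottom-right and left-top, from the column of `X + 2` to that of `X`. -/
lemma slide_IVb {C : Set (Fin 3 → ℝ)} {X Y : ℝ}
    (hC : ∀ x ∈ C, X - 1 ≤ x 0 → x 0 ≤ X + 3 → Y - 1 ≤ x 1 → x 1 ≤ Y + 1 →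
      (x 0 = X - 1 ∧ x 1 = Y) ∨ (x 0 = X + 3 ∧ x 1 = Y) ∨ (x 0 = X ∧ x 1 = Y + 1) ∨
        (x 0 = X + 2 ∧ x 1 = Y - 1)) :
    KnotEquiv (C ∪ (seg X Y 2 1 0 0 1 0 ∪ (seg X Y (-1) 0 0 1 0 0 ∪
        (seg X Y 2 (-1) 0 3 0 0 ∪ seg X Y 1 0 0 2 1 0))))
      (C ∪ (seg X Y 2 (-1) 0 0 (-1) 0 ∪ ((seg X Y 0 (-1) 0 1 0 0 ∪ seg X Y (-1) 0 0 0 1 0) ∪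
        seg X Y 1 0 0 3 0 0))) := by
  -- Both strands use the point (1, 0), one before the slide and the other after it. The first is
  -- therefore retracted to its final position before the second is pushed there.
  have h1 := triangle_move (C ∪ (seg X Y (-1) 0 0 1 0 0 ∪ seg X Y 2 (-1) 0 3 0 0))
    X Y 1 0 0 0 1 0 2 1 0 (by norm_num) (by
      rintro x (hx | hx | hx) α β γ hα hβ hγ hs h0 h1 h2
      · rcases hC x hx (by linarith) (by linarith) (by linarith) (by linarith) with
          ⟨e0, e1⟩ | ⟨e0, e1⟩ | ⟨e0, e1⟩ | ⟨e0, e1⟩ <;> first | (left; linarith) | (right; linarith)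
      all_goals
        obtain ⟨s, hs0, hs1, e0, e1, e2⟩ := mem_seg hx
        first | (left; linarith) | (right; linarith))
  have h2 := triangle_move (C ∪ seg X Y 2 (-1) 0 3 0 0)
    X Y (-1) 0 0 0 1 0 1 0 0 (by norm_num) (by
      rintro x (hx | hx) α β γ hα hβ hγ hs h0 h1 h2
      · rcases hC x hx (by linarith) (by linarith) (by linarith) (by linarith) with
          ⟨e0, e1⟩ | ⟨e0, e1⟩ | ⟨e0, e1⟩ | ⟨e0, e1⟩ <;> first | (left; linarith) | (right; linarith)
      all_goals
        obtain ⟨s, hs0, hs1, e0, e1, e2⟩ := mem_seg hx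
        first | (left; linarith) | (right; linarith))
  have h3 := triangle_move (C ∪ seg X Y (-1) 0 0 0 1 0)
    X Y 2 (-1) 0 3 0 0 1 0 0 (by norm_num) (by
      rintro x (hx | hx) α β γ hα hβ hγ hs h0 h1 h2
      · rcases hC x hx (by linarith) (by linarith) (by linarith) (by linarith) with
          ⟨e0, e1⟩ | ⟨e0, e1⟩ | ⟨e0, e1⟩ | ⟨e0, e1⟩ <;> first | (left; linarith) | (right; linarith)
      all_goals
        obtain ⟨s, hs0, hs1, e0, e1, e2⟩ := mem_seg hx
        first | (left; linarith) | (right; linarith))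
  have h4 := triangle_move (C ∪ (seg X Y (-1) 0 0 0 1 0 ∪ seg X Y 1 0 0 3 0 0))
    X Y 2 (-1) 0 1 0 0 0 (-1) 0 (by norm_num) (by
      rintro x (hx | hx | hx) α β γ hα hβ hγ hs h0 h1 h2
      · rcases hC x hx (by linarith) (by linarith) (by linarith) (by linarith) with
          ⟨e0, e1⟩ | ⟨e0, e1⟩ | ⟨e0, e1⟩ | ⟨e0, e1⟩ <;> first | (left; linarith) | (right; linarith)
      all_goals
        obtain ⟨s, hs0, hs1, e0, e1, e2⟩ := mem_seg hx
        first | (left; linarith) | (right; linarith))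
  exact (KnotEquiv.of_eq (by ac_rfl)).trans <| h1.symm.trans <|
    (KnotEquiv.of_eq (by ac_rfl)).trans <| h2.symm.trans <|
    (KnotEquiv.of_eq (by ac_rfl)).trans <| h3.trans <|
    (KnotEquiv.of_eq (by ac_rfl)).trans <| h4.trans <|
    KnotEquiv.of_eq (by ac_rfl)


/-- The upper end of a strip: a strand ending at `(2, -1)` is pushed across the point `(1, 0)`. -/
lemma push_top {C : Set (Fin 3 → ℝ)} {X Y a b : ℝ} (hab : a = 2 ∧ b = 1 ∨ a = 3 ∧ b = 0)
    (hC : ∀ x ∈ C, x 0 ≤ X + 3 → Y - 1 ≤ x 1 → x 1 ≤ Y + 1 → X - Y + 1 ≤ x 0 - x 1 →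
      (x 0 = X + a ∧ x 1 = Y + b) ∨ (x 0 = X + 2 ∧ x 1 = Y - 1)) :
    KnotEquiv (C ∪ seg X Y 2 (-1) 0 a b 0)
      (C ∪ (seg X Y 2 (-1) 0 0 (-1) 0 ∪ (seg X Y 0 (-1) 0 1 0 0 ∪ seg X Y 1 0 0 a b 0))) := by
  have h1 := triangle_move C X Y 2 (-1) 0 a b 0 1 0 0
    (by rcases hab with ⟨rfl, rfl⟩ | ⟨rfl, rfl⟩ <;> norm_num) (by
      intro x hx α β γ hα hβ hγ hs h0 h1 h2
      rcases hab with ⟨rfl, rfl⟩ | ⟨rfl, rfl⟩ <;>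
      rcases hC x hx (by linarith) (by linarith) (by linarith) (by linarith) with
          ⟨e0, e1⟩ | ⟨e0, e1⟩ <;> first | (left; linarith) | (right; linarith))
  have h2 := triangle_move (C ∪ seg X Y 1 0 0 a b 0) X Y 2 (-1) 0 1 0 0 0 (-1) 0
    (by norm_num) (by
      rintro x (hx | hx) α β γ hα hβ hγ hs h0 h1 h2
      · rcases hab with ⟨rfl, rfl⟩ | ⟨rfl, rfl⟩ <;>
        rcases hC x hx (by linarith) (by linarith) (by linarith) (by linarith) with
          ⟨e0, e1⟩ | ⟨e0, e1⟩ <;> first | (left; linarith) | (right; linarith)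
      · obtain ⟨s, hs0, hs1, e0, e1, e2⟩ := mem_seg hx
        rcases hab with ⟨rfl, rfl⟩ | ⟨rfl, rfl⟩ <;> first | (left; linarith) | (right; linarith))
  exact h1.trans <| (KnotEquiv.of_eq (by ac_rfl)).trans <| h2.trans <| KnotEquiv.of_eq (by ac_rfl)

/-- The lower end of a strip: a strand ending at `(2, 1)` is pushed across the point `(1, 0)`. -/
lemma push_bottom {C : Set (Fin 3 → ℝ)} {X Y a b : ℝ} (hab : a = 2 ∧ b = -1 ∨ a = 3 ∧ b = 0)
    (hC : ∀ x ∈ C, x 0 ≤ X + 3 → Y - 1 ≤ x 1 → x 1 ≤ Y + 1 → X + Y + 1 ≤ x 0 + x 1 →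
      (x 0 = X + a ∧ x 1 = Y + b) ∨ (x 0 = X ∧ x 1 = Y + 1)) :
    KnotEquiv (C ∪ (seg X Y 2 1 0 0 1 0 ∪ seg X Y a b 0 2 1 0))
      (C ∪ (seg X Y 1 0 0 0 1 0 ∪ seg X Y 1 0 0 a b 0)) := by
  rw [seg_symm X Y 1 0 0 a b 0]
  have h1 := triangle_move (C ∪ seg X Y a b 0 1 0 0) X Y 1 0 0 0 1 0 2 1 0
    (by norm_num) (by
      rintro x (hx | hx) α β γ hα hβ hγ hs h0 h1 h2
      · rcases hab with ⟨rfl, rfl⟩ | ⟨rfl, rfl⟩ <;>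
        rcases hC x hx (by linarith) (by linarith) (by linarith) (by linarith) with
          ⟨e0, e1⟩ | ⟨e0, e1⟩ <;> first | (left; linarith) | (right; linarith)
      · obtain ⟨s, hs0, hs1, e0, e1, e2⟩ := mem_seg hx
        rcases hab with ⟨rfl, rfl⟩ | ⟨rfl, rfl⟩ <;> first | (left; linarith) | (right; linarith))
  have h2 := triangle_move (C ∪ seg X Y 2 1 0 0 1 0) X Y a b 0 2 1 0 1 0 0
    (by rcases hab with ⟨rfl, rfl⟩ | ⟨rfl, rfl⟩ <;> norm_num) (by
      rintro x (hx | hx) α β γ hα hβ hγ hs h0 h1 h2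
      · rcases hab with ⟨rfl, rfl⟩ | ⟨rfl, rfl⟩ <;>
        rcases hC x hx (by linarith) (by linarith) (by linarith) (by linarith) with
          ⟨e0, e1⟩ | ⟨e0, e1⟩ <;> first | (left; linarith) | (right; linarith)
      · obtain ⟨s, hs0, hs1, e0, e1, e2⟩ := mem_seg hx
        rcases hab with ⟨rfl, rfl⟩ | ⟨rfl, rfl⟩ <;> first | (left; linarith) | (right; linarith))
  exact (KnotEquiv.of_eq (by ac_rfl)).trans <| h2.trans <| (KnotEquiv.of_eq (by ac_rfl)).trans <|
    h1.symm.trans <| KnotEquiv.of_eq (by ac_rfl)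

/-- The lower end of a strip at a strand that turns up there: the strand is shortened. -/
lemma shorten_bottom {C : Set (Fin 3 → ℝ)} {X Y a b : ℝ} (hab : a = -1 ∧ b = 0 ∨ a = 0 ∧ b = -1)
    (hC : ∀ x ∈ C, X - 1 ≤ x 0 → x 0 ≤ X + 3 → Y - 1 ≤ x 1 → x 1 ≤ Y + 1 →
      (x 0 = X + a ∧ x 1 = Y + b) ∨ (x 0 = X ∧ x 1 = Y + 1)) :
    KnotEquiv (C ∪ (seg X Y 2 1 0 0 1 0 ∪ (seg X Y a b 0 1 0 0 ∪ seg X Y 1 0 0 2 1 0)))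
      (C ∪ seg X Y a b 0 0 1 0) := by
  have h1 := triangle_move (C ∪ seg X Y a b 0 1 0 0) X Y 1 0 0 0 1 0 2 1 0
    (by norm_num) (by
      rintro x (hx | hx) α β γ hα hβ hγ hs h0 h1 h2
      · rcases hab with ⟨rfl, rfl⟩ | ⟨rfl, rfl⟩ <;>
        rcases hC x hx (by linarith) (by linarith) (by linarith) (by linarith) with
          ⟨e0, e1⟩ | ⟨e0, e1⟩ <;> first | (left; linarith) | (right; linarith)
      · obtain ⟨s, hs0, hs1, e0, e1, e2⟩ := mem_seg hx
        rcases hab with ⟨rfl, rfl⟩ | ⟨rfl, rfl⟩ <;> first | (left; linarith) | (right; linarith))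
  have h2 := triangle_move C X Y a b 0 0 1 0 1 0 0
    (by rcases hab with ⟨rfl, rfl⟩ | ⟨rfl, rfl⟩ <;> norm_num) (by
      intro x hx α β γ hα hβ hγ hs h0 h1 h2
      rcases hab with ⟨rfl, rfl⟩ | ⟨rfl, rfl⟩ <;>
      rcases hC x hx (by linarith) (by linarith) (by linarith) (by linarith) with
          ⟨e0, e1⟩ | ⟨e0, e1⟩ <;> first | (left; linarith) | (right; linarith))
  exact (KnotEquiv.of_eq (by ac_rfl)).trans <| h1.symm.trans <|
    (KnotEquiv.of_eq (by ac_rfl)).trans <| h2.symm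

/-- A Reidemeister move of type I: an arc from `(-1, 0)` to `(0, -1)` is given a kink that runs around
the square with centre `(1, 1)`. -/
lemma add_kink {C : Set (Fin 3 → ℝ)} {X Y : ℝ}
    (hC : ∀ x ∈ C, X + Y - 1 ≤ x 0 + x 1 → x 0 + x 1 ≤ X + Y + 3 → X - Y - 1 ≤ x 0 - x 1 →
      x 0 - x 1 ≤ X - Y + 1 → (x 0 = X - 1 ∧ x 1 = Y) ∨ (x 0 = X ∧ x 1 = Y - 1)) :
    KnotEquiv (C ∪ seg X Y (-1) 0 0 0 (-1) 0)
      (C ∪ (((seg X Y (-1) 0 0 0 0 1 ∪ seg X Y 0 0 1 1 0 0) ∪ seg X Y 0 (-1) 0 0 1 0) ∪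
        (seg X Y 1 0 0 2 1 0 ∪ (seg X Y 0 1 0 1 2 0 ∪ seg X Y 1 2 0 2 1 0)))) := by
  rw [seg_symm X Y 0 (-1) 0 0 1 0, seg_symm X Y 0 1 0 1 2 0, seg_symm X Y 1 2 0 2 1 0]
  -- Once the strand has been lifted to the apex (0, 0, 1), the loop is opened by a fan of triangles
  -- sharing that apex, through (1, 2), (2, 1) and (1, 0). The apex ends as the over-pass above the
  -- lower left cell.
  have h1 := triangle_move C X Y (-1) 0 0 0 (-1) 0 0 1 0 (by norm_num) (by
      intro x hx α β γ hα hβ hγ hs h0 h1 h2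
      rcases hC x hx (by linarith) (by linarith) (by linarith) (by linarith) with
          ⟨e0, e1⟩ | ⟨e0, e1⟩ <;> first | (left; linarith) | (right; linarith))
  have h2 := triangle_move (C ∪ seg X Y 0 1 0 0 (-1) 0) X Y (-1) 0 0 0 1 0 0 0 1 (by norm_num) (by
      rintro x (hx | hx) α β γ hα hβ hγ hs h0 h1 h2
      · rcases hC x hx (by linarith) (by linarith) (by linarith) (by linarith) with
          ⟨e0, e1⟩ | ⟨e0, e1⟩ <;> first | (left; linarith) | (right; linarith)
      · obtain ⟨s, hs0, hs1, e0, e1, e2⟩ := mem_seg hx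
        first | (left; linarith) | (right; linarith))
  have h3 := triangle_move (C ∪ (seg X Y (-1) 0 0 0 0 1 ∪ seg X Y 0 1 0 0 (-1) 0))
    X Y 0 0 1 0 1 0 1 2 0 (by norm_num) (by
      rintro x (hx | hx | hx) α β γ hα hβ hγ hs h0 h1 h2
      · rcases hC x hx (by linarith) (by linarith) (by linarith) (by linarith) with
          ⟨e0, e1⟩ | ⟨e0, e1⟩ <;> first | (left; linarith) | (right; linarith)
      all_goals
        obtain ⟨s, hs0, hs1, e0, e1, e2⟩ := mem_seg hx
        first | (left; linarith) | (right; linarith))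
  have h4 := triangle_move (C ∪ (seg X Y (-1) 0 0 0 0 1 ∪ seg X Y 0 1 0 0 (-1) 0 ∪
      seg X Y 1 2 0 0 1 0)) X Y 0 0 1 1 2 0 2 1 0 (by norm_num) (by
      rintro x (hx | (hx | hx) | hx) α β γ hα hβ hγ hs h0 h1 h2
      · rcases hC x hx (by linarith) (by linarith) (by linarith) (by linarith) with
          ⟨e0, e1⟩ | ⟨e0, e1⟩ <;> first | (left; linarith) | (right; linarith)
      all_goals
        obtain ⟨s, hs0, hs1, e0, e1, e2⟩ := mem_seg hx
        first | (left; linarith) | (right; linarith))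
  have h5 := triangle_move (C ∪ (seg X Y (-1) 0 0 0 0 1 ∪ seg X Y 0 1 0 0 (-1) 0 ∪
      seg X Y 1 2 0 0 1 0 ∪ seg X Y 2 1 0 1 2 0)) X Y 0 0 1 2 1 0 1 0 0 (by norm_num) (by
      rintro x (hx | ((hx | hx) | hx) | hx) α β γ hα hβ hγ hs h0 h1 h2
      · rcases hC x hx (by linarith) (by linarith) (by linarith) (by linarith) with
          ⟨e0, e1⟩ | ⟨e0, e1⟩ <;> first | (left; linarith) | (right; linarith)
      all_goals
        obtain ⟨s, hs0, hs1, e0, e1, e2⟩ := mem_seg hx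
        first | (left; linarith) | (right; linarith))
  exact h1.trans <| (KnotEquiv.of_eq (by ac_rfl)).trans <| h2.trans <|
    (KnotEquiv.of_eq (by ac_rfl)).trans <| h3.trans <|
    (KnotEquiv.of_eq (by ac_rfl)).trans <| h4.trans <|
    (KnotEquiv.of_eq (by ac_rfl)).trans <| h5.trans <| KnotEquiv.of_eq (by ac_rfl)


/-! ### Links of tile arrays, cell by cell -/

instance (t : Tile) (s : Side) : Decidable (t.Uses s) := by unfold Tile.Uses; infer_instance

/-- The part of a link drawn on one cell. -/
def cellSet (i j : ℤ) (t : Tile) : Set (Fin 3 → ℝ) := {x | ∃ a ∈ t.strands, x ∈ strandSet i j t a}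

/-- The polygonal set drawn by an arbitrary array of tiles. -/
def arrayLink (f : ℤ → ℤ → Tile) : Set (Fin 3 → ℝ) := {x | ∃ i j, x ∈ cellSet i j (f i j)}

lemma lift_left (i j : ℤ) : lift (sidePt i j .left) 0 = pt (2 * j) (2 * i) (-1) 0 0 := by
  rw [eq_pt_iff]; simp [lift, sidePt]; ring
lemma lift_right (i j : ℤ) : lift (sidePt i j .right) 0 = pt (2 * j) (2 * i) 1 0 0 := by
  rw [eq_pt_iff]; simp [lift, sidePt]
lemma lift_bottom (i j : ℤ) : lift (sidePt i j .bottom) 0 = pt (2 * j) (2 * i) 0 (-1) 0 := by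
  rw [eq_pt_iff]; simp [lift, sidePt]; ring
lemma lift_top (i j : ℤ) : lift (sidePt i j .top) 0 = pt (2 * j) (2 * i) 0 1 0 := by
  rw [eq_pt_iff]; simp [lift, sidePt]
lemma lift_centre (i j : ℤ) : lift (2 * j, 2 * i) 1 = pt (2 * j) (2 * i) 0 0 1 := by
  rw [eq_pt_iff]; simp [lift]

section
variable (i j : ℤ)

lemma cellSet_I : cellSet i j .I = ∅ := by
  ext x; simp [cellSet, Tile.strands]

lemma cellSet_IIa : cellSet i j .IIa = seg (2 * j) (2 * i) (-1) 0 0 0 (-1) 0 := by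
  ext x; simp [cellSet, Tile.strands, strandSet, Tile.IsOver, seg, lift_left, lift_bottom]

lemma cellSet_IIb : cellSet i j .IIb = seg (2 * j) (2 * i) 0 (-1) 0 1 0 0 := by
  ext x; simp [cellSet, Tile.strands, strandSet, Tile.IsOver, seg, lift_right, lift_bottom]

lemma cellSet_IIc : cellSet i j .IIc = seg (2 * j) (2 * i) 1 0 0 0 1 0 := by
  ext x; simp [cellSet, Tile.strands, strandSet, Tile.IsOver, seg, lift_right, lift_top]

lemma cellSet_IId : cellSet i j .IId = seg (2 * j) (2 * i) (-1) 0 0 0 1 0 := by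
  ext x; simp [cellSet, Tile.strands, strandSet, Tile.IsOver, seg, lift_left, lift_top]

lemma cellSet_IIIa : cellSet i j .IIIa = seg (2 * j) (2 * i) (-1) 0 0 1 0 0 := by
  ext x; simp [cellSet, Tile.strands, strandSet, Tile.IsOver, seg, lift_left, lift_right]

lemma cellSet_IIIb : cellSet i j .IIIb = seg (2 * j) (2 * i) 0 (-1) 0 0 1 0 := by
  ext x; simp [cellSet, Tile.strands, strandSet, Tile.IsOver, seg, lift_bottom, lift_top]

lemma cellSet_IVa : cellSet i j .IVa =
    seg (2 * j) (2 * i) (-1) 0 0 0 (-1) 0 ∪ seg (2 * j) (2 * i) 1 0 0 0 1 0 := by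
  ext x
  simp [cellSet, Tile.strands, strandSet, Tile.IsOver, seg, lift_left, lift_bottom, lift_right,
    lift_top]

lemma cellSet_IVb : cellSet i j .IVb =
    seg (2 * j) (2 * i) 0 (-1) 0 1 0 0 ∪ seg (2 * j) (2 * i) (-1) 0 0 0 1 0 := by
  ext x
  simp [cellSet, Tile.strands, strandSet, Tile.IsOver, seg, lift_left, lift_bottom, lift_right,
    lift_top]

lemma cellSet_Va : cellSet i j .Va =
    (seg (2 * j) (2 * i) (-1) 0 0 0 0 1 ∪ seg (2 * j) (2 * i) 0 0 1 1 0 0) ∪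
      seg (2 * j) (2 * i) 0 (-1) 0 0 1 0 := by
  ext x
  simp [cellSet, Tile.strands, strandSet, Tile.IsOver, seg, lift_left, lift_bottom, lift_right,
    lift_top, lift_centre]

lemma cellSet_Vb : cellSet i j .Vb = seg (2 * j) (2 * i) (-1) 0 0 1 0 0 ∪
    (seg (2 * j) (2 * i) 0 (-1) 0 0 0 1 ∪ seg (2 * j) (2 * i) 0 0 1 0 1 0) := by
  ext x
  simp [cellSet, Tile.strands, strandSet, Tile.IsOver, seg, lift_left, lift_bottom, lift_right,
    lift_top, lift_centre]

end

/-- A straight piece inside the diamond of a cell whose ends are midpoints of sides or lie above the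
centre. -/
lemma cellSet_diamond {i j : ℤ} {t : Tile} {x : Fin 3 → ℝ} (h : x ∈ cellSet i j t) :
    ((x 0 - 2 * j) + (x 1 - 2 * i) ≤ 1 ∧ (x 0 - 2 * j) - (x 1 - 2 * i) ≤ 1 ∧
      -1 ≤ (x 0 - 2 * j) + (x 1 - 2 * i) ∧ -1 ≤ (x 0 - 2 * j) - (x 1 - 2 * i)) ∧
    (x 0 = 2 * j - 1 → t.Uses .left) ∧ (x 0 = 2 * j + 1 → t.Uses .right) ∧
    (x 1 = 2 * i - 1 → t.Uses .bottom) ∧ (x 1 = 2 * i + 1 → t.Uses .top) := by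
  cases t
  case I => rw [cellSet_I] at h; exact h.elim
  all_goals
    first
    | rw [cellSet_IIa] at h | rw [cellSet_IIb] at h | rw [cellSet_IIc] at h
    | rw [cellSet_IId] at h | rw [cellSet_IIIa] at h | rw [cellSet_IIIb] at h
    | (rw [cellSet_IVa] at h; rcases h with h | h)
    | (rw [cellSet_IVb] at h; rcases h with h | h)
    | (rw [cellSet_Va] at h; rcases h with (h | h) | h)
    | (rw [cellSet_Vb] at h; rcases h with h | h | h)
  all_goals
    obtain ⟨s, hs0, hs1, e0, e1, -⟩ := mem_seg h
    refine ⟨⟨by linarith, by linarith, by linarith, by linarith⟩, fun e => ?_, fun e => ?_,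
      fun e => ?_, fun e => ?_⟩ <;> first | decide | (exfalso; linarith)

/-- The part of `arrayLink f` outside the cells `(r, j)` and `(r, j + 1)`. -/
def offDomino (f : ℤ → ℤ → Tile) (r j : ℤ) : Set (Fin 3 → ℝ) :=
  {x | ∃ a b, ¬ (a = r ∧ (b = j ∨ b = j + 1)) ∧ x ∈ cellSet a b (f a b)}

lemma arrayLink_eq_domino (f : ℤ → ℤ → Tile) (r j : ℤ) :
    arrayLink f = offDomino f r j ∪ (cellSet r j (f r j) ∪ cellSet r (j + 1) (f r (j + 1))) := by
  ext x
  constructor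
  · rintro ⟨a, b, hx⟩
    by_cases h : a = r ∧ (b = j ∨ b = j + 1)
    · obtain ⟨rfl, rfl | rfl⟩ := h
      · exact Or.inr (Or.inl hx)
      · exact Or.inr (Or.inr hx)
    · exact Or.inl ⟨a, b, h, hx⟩
  · rintro (⟨a, b, -, hx⟩ | hx | hx)
    exacts [⟨a, b, hx⟩, ⟨_, _, hx⟩, ⟨_, _, hx⟩]

lemma offDomino_congr {f g : ℤ → ℤ → Tile} {r j : ℤ}
    (h : ∀ a b, ¬ (a = r ∧ (b = j ∨ b = j + 1)) → g a b = f a b) :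
    offDomino g r j = offDomino f r j := by
  ext x
  constructor <;> rintro ⟨a, b, hab, hx⟩ <;> refine ⟨a, b, hab, ?_⟩
  · rwa [h a b hab] at hx
  · rwa [h a b hab]

/-- The diamonds inscribed in distinct cells meet at most in a common side midpoint. So the rest of
the link touches the 1 × 2 rectangle at no more than six midpoints, each time through a strand end
of a neighbouring tile. -/
lemma offDomino_contact {f : ℤ → ℤ → Tile} {r j : ℤ} {x : Fin 3 → ℝ} (hx : x ∈ offDomino f r j)
    (h0 : (2 * j : ℝ) - 1 ≤ x 0) (h0' : x 0 ≤ 2 * j + 3) (h1 : (2 * r : ℝ) - 1 ≤ x 1)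
    (h1' : x 1 ≤ 2 * r + 1) :
    (x 0 = 2 * j - 1 ∧ x 1 = 2 * r ∧ (f r (j - 1)).Uses .right) ∨
    (x 0 = 2 * j + 3 ∧ x 1 = 2 * r ∧ (f r (j + 2)).Uses .left) ∨
    (x 0 = 2 * j ∧ x 1 = 2 * r + 1 ∧ (f (r + 1) j).Uses .bottom) ∨
    (x 0 = 2 * j + 2 ∧ x 1 = 2 * r + 1 ∧ (f (r + 1) (j + 1)).Uses .bottom) ∨
    (x 0 = 2 * j ∧ x 1 = 2 * r - 1 ∧ (f (r - 1) j).Uses .top) ∨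
    (x 0 = 2 * j + 2 ∧ x 1 = 2 * r - 1 ∧ (f (r - 1) (j + 1)).Uses .top) := by
  obtain ⟨a, b, hab, hx⟩ := hx
  obtain ⟨a, rfl⟩ : ∃ c, a = r + c := ⟨a - r, by ring⟩
  obtain ⟨b, rfl⟩ : ∃ c, b = j + c := ⟨b - j, by ring⟩
  obtain ⟨⟨d1, d2, d3, d4⟩, ul, ur, ub, ut⟩ := cellSet_diamond hx
  push_cast at d1 d2 d3 d4 ul ur ub ut
  have a1 : a < 2 := by
    have : (a : ℝ) < 2 := by linarith
    exact_mod_cast this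
  have a2 : -2 < a := by
    have : (-2 : ℝ) < a := by linarith
    exact_mod_cast this
  have b1 : b < 3 := by
    have : (b : ℝ) < 3 := by linarith
    exact_mod_cast this
  have b2 : -2 < b := by
    have : (-2 : ℝ) < b := by linarith
    exact_mod_cast this
  interval_cases a <;> interval_cases b <;> norm_num at d1 d2 d3 d4 ul ur ub ut hab
  · exfalso; linarith
  · exact Or.inr <| Or.inr <| Or.inr <| Or.inr <| Or.inl
      ⟨by linarith, by linarith, by simpa [sub_eq_add_neg] using ut (by linarith)⟩
  · exact Or.inr <| Or.inr <| Or.inr <| Or.inr <| Or.inr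
      ⟨by linarith, by linarith, by simpa [sub_eq_add_neg] using ut (by linarith)⟩
  · exfalso; linarith
  · exact Or.inl ⟨by linarith, by linarith, by simpa [sub_eq_add_neg] using ur (by linarith)⟩
  · exact Or.inr <| Or.inl ⟨by linarith, by linarith, by simpa using ul (by linarith)⟩
  · exfalso; linarith
  · exact Or.inr <| Or.inr <| Or.inl
      ⟨by linarith, by linarith, by simpa using ub (by linarith)⟩
  · exact Or.inr <| Or.inr <| Or.inr <| Or.inl
      ⟨by linarith, by linarith, by simpa using ub (by linarith)⟩
  · exfalso; linarith


lemma seg_add_right (X Y u a b c a' b' c' : ℝ) :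
    seg (X + u) Y a b c a' b' c' = seg X Y (u + a) b c (u + a') b' c' := by
  simp only [seg, pt, add_assoc]

lemma seg_add_up (X Y u a b c a' b' c' : ℝ) :
    seg X (Y + u) a b c a' b' c' = seg X Y a (u + b) c a' (u + b') c' := by
  simp only [seg, pt, add_assoc]

lemma two_mul_cast_succ (j : ℤ) : (2 : ℝ) * ((j + 1 : ℤ) : ℝ) = 2 * j + 2 := by push_cast; ring

lemma two_add_one : (2 : ℝ) + 1 = 3 := by norm_num
lemma two_add_neg_one : (2 : ℝ) + -1 = 1 := by norm_num

/-! ### Shifting a strip one row at a time -/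

/-- A horizontal segment joining the columns `j` and `j + 1` on the line between the rows `r` and
`r + 1`. -/
def jog (r j : ℤ) : Set (Fin 3 → ℝ) := seg (2 * j) (2 * r + 1) 2 0 0 0 0 0

lemma jog_eq (r j : ℤ) : jog r j = seg (2 * j) (2 * r) 2 1 0 0 1 0 := by
  rw [jog, seg_add_up]; norm_num

lemma jog_pred_eq (r j : ℤ) : jog (r - 1) j = seg (2 * j) (2 * r) 2 (-1) 0 0 (-1) 0 := by
  rw [jog, show (2 : ℝ) * ((r - 1 : ℤ) : ℝ) + 1 = 2 * r + -1 by push_cast; ring, seg_add_up]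
  norm_num

/-- The four tiles on which all four sides are used. -/
def Tile.IsFull (t : Tile) : Prop := t = .Va ∨ t = .Vb ∨ t = .IVa ∨ t = .IVb

/-- Sliding a vertical strand by one column to the left across the tiles of one row. -/
lemma slide_row {f g : ℤ → ℤ → Tile} {r j : ℤ}
    (hfg : ∀ a b, ¬ (a = r ∧ (b = j ∨ b = j + 1)) → g a b = f a b)
    (hf : f r j = .IIIa) (ht : (f r (j + 1)).IsFull) (hg : g r j = f r (j + 1))
    (hg' : g r (j + 1) = .IIIa) (h1 : ¬ (f (r + 1) (j + 1)).Uses .bottom)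
    (h2 : ¬ (f (r - 1) j).Uses .top) :
    KnotEquiv (arrayLink f ∪ jog r j) (arrayLink g ∪ jog (r - 1) j) := by
  have hC : ∀ x ∈ offDomino f r j, (2 * j : ℝ) - 1 ≤ x 0 → x 0 ≤ 2 * j + 3 →
      (2 * r : ℝ) - 1 ≤ x 1 → x 1 ≤ 2 * r + 1 →
      (x 0 = 2 * j - 1 ∧ x 1 = 2 * r) ∨ (x 0 = 2 * j + 3 ∧ x 1 = 2 * r) ∨
        (x 0 = 2 * j ∧ x 1 = 2 * r + 1) ∨ (x 0 = 2 * j + 2 ∧ x 1 = 2 * r - 1) := by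
    intro x hx a b c d
    rcases offDomino_contact hx a b c d with h | h | h | h | h | h
    · exact Or.inl ⟨h.1, h.2.1⟩
    · exact Or.inr (Or.inl ⟨h.1, h.2.1⟩)
    · exact Or.inr (Or.inr (Or.inl ⟨h.1, h.2.1⟩))
    · exact absurd h.2.2 h1
    · exact absurd h.2.2 h2
    · exact Or.inr (Or.inr (Or.inr ⟨h.1, h.2.1⟩))
  rw [arrayLink_eq_domino f r j, arrayLink_eq_domino g r j, offDomino_congr hfg, hf, hg, hg',
    jog_eq, jog_pred_eq]
  rcases ht with h | h | h | h <;> rw [h] <;>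
    simp only [cellSet_Va, cellSet_Vb, cellSet_IVa, cellSet_IVb, cellSet_IIIa, two_mul_cast_succ,
      seg_add_right, add_zero, two_add_one, two_add_neg_one]
  · exact (KnotEquiv.of_eq (by ac_rfl)).trans ((slide_under hC).trans (KnotEquiv.of_eq (by ac_rfl)))
  · exact (KnotEquiv.of_eq (by ac_rfl)).trans ((slide_over hC).trans (KnotEquiv.of_eq (by ac_rfl)))
  · exact (KnotEquiv.of_eq (by ac_rfl)).trans ((slide_IVa hC).trans (KnotEquiv.of_eq (by ac_rfl)))
  · exact (KnotEquiv.of_eq (by ac_rfl)).trans ((slide_IVb hC).trans (KnotEquiv.of_eq (by ac_rfl)))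

/-- The left tile of the upper end of a strip after the shift: an arc bottom-right is added. -/
def Tile.topLeft : Tile → Tile
  | .I => .IIb
  | .IId => .IVb
  | t => t

/-- The right tile of the upper end of a strip after the shift: the strand end at the bottom moves to
the left. -/
def Tile.topRight : Tile → Tile
  | .IIIb => .IId
  | .IIb => .IIIa
  | t => t

/-- The left tile of the lower end of a strip after the shift: an arc right-top is added, or a strand
end on the right moves to the top. -/
def Tile.bottomLeft : Tile → Tile
  | .I => .IIc
  | .IIa => .IVa
  | .IIIa => .IId
  | .IIb => .IIIb
  | t => t

/-- The right tile of the lower end of a strip after the shift: a strand end at the top moves to the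
left, or an arc left-top is removed. -/
def Tile.bottomRight : Tile → Tile
  | .IIIb => .IIa
  | .IIc => .IIIa
  | .IId => .I
  | t => t

/-- Starts a shift: the strand is bent to the left in the top row and rejoins its old column along
the jog below that row. `h1`, `h2` and `h3` exclude foreign strand ends at the midpoints that the
bending sweeps over. -/
lemma shift_top {f g : ℤ → ℤ → Tile} {r j : ℤ}
    (hfg : ∀ a b, ¬ (a = r ∧ (b = j ∨ b = j + 1)) → g a b = f a b)
    (hl : f r j = .I ∨ f r j = .IId) (hr : f r (j + 1) = .IIIb ∨ f r (j + 1) = .IIb)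
    (hg : g r j = (f r j).topLeft) (hg' : g r (j + 1) = (f r (j + 1)).topRight)
    (h1 : (f r (j + 2)).Uses .left → (f r (j + 1)).Uses .right)
    (h2 : (f (r + 1) (j + 1)).Uses .bottom → (f r (j + 1)).Uses .top)
    (h3 : ¬ (f (r - 1) j).Uses .top) :
    KnotEquiv (arrayLink f) (arrayLink g ∪ jog (r - 1) j) := by
  rw [arrayLink_eq_domino f r j, arrayLink_eq_domino g r j, offDomino_congr hfg, hg, hg',
    jog_pred_eq]
  -- The triangles of `push_top` lie where x - y is at least 1 in local coordinates; a left-top arc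
  -- has x - y = -1.
  have hD : ∀ x ∈ cellSet r j (f r j), (2 * j : ℝ) - 2 * r + 1 ≤ x 0 - x 1 → False := by
    intro x hx h
    rcases hl with e | e <;> rw [e] at hx
    · rw [cellSet_I] at hx; exact hx
    · rw [cellSet_IId] at hx
      obtain ⟨s, hs0, hs1, e0, e1, -⟩ := mem_seg hx
      linarith
  have key : ∀ a b : ℝ, (a = 2 ∧ b = 1 ∧ ¬ (f r (j + 2)).Uses .left) ∨
      (a = 3 ∧ b = 0 ∧ ¬ (f (r + 1) (j + 1)).Uses .bottom) →
      ∀ x ∈ offDomino f r j ∪ cellSet r j (f r j), x 0 ≤ 2 * j + 3 → 2 * (r : ℝ) - 1 ≤ x 1 →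
      x 1 ≤ 2 * r + 1 → (2 * j : ℝ) - 2 * r + 1 ≤ x 0 - x 1 →
      (x 0 = 2 * j + a ∧ x 1 = 2 * r + b) ∨ (x 0 = 2 * j + 2 ∧ x 1 = 2 * r - 1) := by
    rintro a b hab x (hx | hx) c1 c2 c3 c4
    · rcases offDomino_contact hx (by linarith) c1 c2 c3 with h | h | h | h | h | h
      · linarith [h.1, h.2.1]
      · rcases hab with ⟨rfl, rfl, h'⟩ | ⟨rfl, rfl, -⟩
        · exact absurd h.2.2 h'
        · exact Or.inl ⟨h.1, by linarith [h.2.1]⟩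
      · linarith [h.1, h.2.1]
      · rcases hab with ⟨rfl, rfl, -⟩ | ⟨rfl, rfl, h'⟩
        · exact Or.inl ⟨h.1, h.2.1⟩
        · exact absurd h.2.2 h'
      · exact absurd h.2.2 h3
      · exact Or.inr ⟨h.1, h.2.1⟩
    · exact (hD x hx c4).elim
  have e1 : ∀ K : Set (Fin 3 → ℝ), cellSet r j (f r j).topLeft ∪ K =
      cellSet r j (f r j) ∪ (seg (2 * j) (2 * r) 0 (-1) 0 1 0 0 ∪ K) := by
    intro K
    rcases hl with e | e <;> rw [e] <;>
      simp only [Tile.topLeft, cellSet_I, cellSet_IId, cellSet_IVb, cellSet_IIb, Set.empty_union]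
    ac_rfl
  rw [e1]
  rcases hr with e | e <;> rw [e] <;> rw [e] at h1 h2 <;>
    simp only [Tile.topRight, cellSet_IIIb, cellSet_IIb, cellSet_IId, cellSet_IIIa,
      two_mul_cast_succ, seg_add_right, add_zero, two_add_one, two_add_neg_one]
  · have := push_top (Or.inl ⟨rfl, rfl⟩) (key 2 1 (Or.inl ⟨rfl, rfl, fun h => by
      have := h1 h; revert this; decide⟩))
    exact (KnotEquiv.of_eq (by ac_rfl)).trans (this.trans (KnotEquiv.of_eq (by ac_rfl)))
  · have := push_top (Or.inr ⟨rfl, rfl⟩) (key 3 0 (Or.inr ⟨rfl, rfl, fun h => by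
      have := h2 h; revert this; decide⟩))
    exact (KnotEquiv.of_eq (by ac_rfl)).trans (this.trans (KnotEquiv.of_eq (by ac_rfl)))

/-- Ends a shift at a strand that continues downwards or to the right: the jog is absorbed by moving
the strand to the left again. -/
lemma shift_bottom {f g : ℤ → ℤ → Tile} {r j : ℤ}
    (hfg : ∀ a b, ¬ (a = r ∧ (b = j ∨ b = j + 1)) → g a b = f a b)
    (hl : f r j = .I ∨ f r j = .IIa) (hr : f r (j + 1) = .IIIb ∨ f r (j + 1) = .IIc)
    (hg : g r j = (f r j).bottomLeft) (hg' : g r (j + 1) = (f r (j + 1)).bottomRight)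
    (h1 : (f r (j + 2)).Uses .left → (f r (j + 1)).Uses .right)
    (h2 : (f (r - 1) (j + 1)).Uses .top → (f r (j + 1)).Uses .bottom)
    (h3 : ¬ (f (r + 1) (j + 1)).Uses .bottom) :
    KnotEquiv (arrayLink f ∪ jog r j) (arrayLink g) := by
  rw [arrayLink_eq_domino f r j, arrayLink_eq_domino g r j, offDomino_congr hfg, hg, hg',
    jog_eq]
  have hD : ∀ x ∈ cellSet r j (f r j), (2 * j : ℝ) + 2 * r + 1 ≤ x 0 + x 1 → False := by
    intro x hx h
    rcases hl with e | e <;> rw [e] at hx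
    · rw [cellSet_I] at hx; exact hx
    · rw [cellSet_IIa] at hx
      obtain ⟨s, hs0, hs1, e0, e1, -⟩ := mem_seg hx
      linarith
  have key : ∀ a b : ℝ, (a = 2 ∧ b = -1 ∧ ¬ (f r (j + 2)).Uses .left) ∨
      (a = 3 ∧ b = 0 ∧ ¬ (f (r - 1) (j + 1)).Uses .top) →
      ∀ x ∈ offDomino f r j ∪ cellSet r j (f r j), x 0 ≤ 2 * j + 3 → 2 * (r : ℝ) - 1 ≤ x 1 →
      x 1 ≤ 2 * r + 1 → (2 * j : ℝ) + 2 * r + 1 ≤ x 0 + x 1 →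
      (x 0 = 2 * j + a ∧ x 1 = 2 * r + b) ∨ (x 0 = 2 * j ∧ x 1 = 2 * r + 1) := by
    rintro a b hab x (hx | hx) c1 c2 c3 c4
    · rcases offDomino_contact hx (by linarith) c1 c2 c3 with h | h | h | h | h | h
      · linarith [h.1, h.2.1]
      · rcases hab with ⟨rfl, rfl, h'⟩ | ⟨rfl, rfl, -⟩
        · exact absurd h.2.2 h'
        · exact Or.inl ⟨h.1, by linarith [h.2.1]⟩
      · exact Or.inr ⟨h.1, h.2.1⟩
      · exact absurd h.2.2 h3
      · linarith [h.1, h.2.1]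
      · rcases hab with ⟨rfl, rfl, -⟩ | ⟨rfl, rfl, h'⟩
        · exact Or.inl ⟨h.1, by linarith [h.2.1]⟩
        · exact absurd h.2.2 h'
    · exact (hD x hx c4).elim
  have e1 : ∀ K : Set (Fin 3 → ℝ), cellSet r j (f r j).bottomLeft ∪ K =
      cellSet r j (f r j) ∪ (seg (2 * j) (2 * r) 1 0 0 0 1 0 ∪ K) := by
    intro K
    rcases hl with e | e <;> rw [e] <;>
      simp only [Tile.bottomLeft, cellSet_I, cellSet_IIa, cellSet_IVa, cellSet_IIc, Set.empty_union]
    ac_rfl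
  rw [e1]
  rcases hr with e | e <;> rw [e] <;> rw [e] at h1 h2 <;>
    simp only [Tile.bottomRight, cellSet_IIIb, cellSet_IIa, cellSet_IIc, cellSet_IIIa,
      two_mul_cast_succ, seg_add_right, add_zero, two_add_one, two_add_neg_one]
  · have := push_bottom (Or.inl ⟨rfl, rfl⟩) (key 2 (-1) (Or.inl ⟨rfl, rfl, fun h => by
      have := h1 h; revert this; decide⟩))
    exact (KnotEquiv.of_eq (by ac_rfl)).trans (this.trans (KnotEquiv.of_eq (by ac_rfl)))
  · have := push_bottom (Or.inr ⟨rfl, rfl⟩) (key 3 0 (Or.inr ⟨rfl, rfl, fun h => by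
      have := h2 h; revert this; decide⟩))
    exact (KnotEquiv.of_eq (by ac_rfl)).trans (this.trans (KnotEquiv.of_eq (by ac_rfl)))

/-- Ends a shift at a strand that comes from the left tile and turns up in the right one: its detour
through the right column retracts, so the right tile becomes blank. -/
lemma shift_bottom_turn {f g : ℤ → ℤ → Tile} {r j : ℤ}
    (hfg : ∀ a b, ¬ (a = r ∧ (b = j ∨ b = j + 1)) → g a b = f a b)
    (hl : f r j = .IIIa ∨ f r j = .IIb) (hr : f r (j + 1) = .IId)
    (hg : g r j = (f r j).bottomLeft) (hg' : g r (j + 1) = (f r (j + 1)).bottomRight)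
    (h1 : (f r (j + 2)).Uses .left → (f r (j + 1)).Uses .right)
    (h2 : (f (r - 1) (j + 1)).Uses .top → (f r (j + 1)).Uses .bottom)
    (h3 : ¬ (f (r + 1) (j + 1)).Uses .bottom)
    (h4 : (f r (j - 1)).Uses .right → (f r j).Uses .left)
    (h5 : (f (r - 1) j).Uses .top → (f r j).Uses .bottom) :
    KnotEquiv (arrayLink f ∪ jog r j) (arrayLink g) := by
  rw [arrayLink_eq_domino f r j, arrayLink_eq_domino g r j, offDomino_congr hfg, hg, hg', hr,
    jog_eq]
  rw [hr] at h1 h2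
  have h1' : ¬ (f r (j + 2)).Uses .left := fun h => by have := h1 h; revert this; decide
  have h2' : ¬ (f (r - 1) (j + 1)).Uses .top := fun h => by have := h2 h; revert this; decide
  have key : ∀ a b : ℝ, (a = -1 ∧ b = 0 ∧ ¬ (f (r - 1) j).Uses .top) ∨
      (a = 0 ∧ b = -1 ∧ ¬ (f r (j - 1)).Uses .right) →
      ∀ x ∈ offDomino f r j, (2 * j : ℝ) - 1 ≤ x 0 → x 0 ≤ 2 * j + 3 → 2 * (r : ℝ) - 1 ≤ x 1 →
      x 1 ≤ 2 * r + 1 →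
      (x 0 = 2 * j + a ∧ x 1 = 2 * r + b) ∨ (x 0 = 2 * j ∧ x 1 = 2 * r + 1) := by
    intro a b hab x hx c0 c1 c2 c3
    rcases offDomino_contact hx c0 c1 c2 c3 with h | h | h | h | h | h
    · rcases hab with ⟨rfl, rfl, -⟩ | ⟨rfl, rfl, h'⟩
      · exact Or.inl ⟨by linarith [h.1], by linarith [h.2.1]⟩
      · exact absurd h.2.2 h'
    · exact absurd h.2.2 h1'
    · exact Or.inr ⟨h.1, h.2.1⟩
    · exact absurd h.2.2 h3
    · rcases hab with ⟨rfl, rfl, h'⟩ | ⟨rfl, rfl, -⟩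
      · exact absurd h.2.2 h'
      · exact Or.inl ⟨by linarith [h.1], by linarith [h.2.1]⟩
    · exact absurd h.2.2 h2'
  rcases hl with e | e <;> rw [e] <;> rw [e] at h4 h5 <;>
    simp only [Tile.bottomRight, Tile.bottomLeft, cellSet_IIIa, cellSet_IIIb, cellSet_IIb,
      cellSet_IId, cellSet_I, Set.union_empty, two_mul_cast_succ, seg_add_right, add_zero,
      two_add_neg_one]
  · have := shorten_bottom (Or.inl ⟨rfl, rfl⟩) (key (-1) 0 (Or.inl ⟨rfl, rfl, fun h => by
      have := h5 h; revert this; decide⟩))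
    exact (KnotEquiv.of_eq (by ac_rfl)).trans (this.trans (KnotEquiv.of_eq (by ac_rfl)))
  · have := shorten_bottom (Or.inr ⟨rfl, rfl⟩) (key 0 (-1) (Or.inr ⟨rfl, rfl, fun h => by
      have := h4 h; revert this; decide⟩))
    exact (KnotEquiv.of_eq (by ac_rfl)).trans (this.trans (KnotEquiv.of_eq (by ac_rfl)))


/-! ### Strips and their shift -/

/-- Every strand end on a side of a cell is met by a strand end of the neighbouring cell. -/
def ArrayConnected (f : ℤ → ℤ → Tile) : Prop :=
  ∀ i j : ℤ, ((f i j).Uses .right ↔ (f i (j + 1)).Uses .left) ∧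
    ((f i j).Uses .top ↔ (f (i + 1) j).Uses .bottom)

/-- The tiles in the columns `j` and `j + 1` and the rows from `q` to `i` form a strip along which the
vertical strand in column `j + 1` can be moved to column `j`. -/
structure IsStrip (f : ℤ → ℤ → Tile) (j q i : ℤ) : Prop where
  lt : q < i
  topLeft : f i j = .I ∨ f i j = .IId
  topRight : f i (j + 1) = .IIIb ∨ f i (j + 1) = .IIb
  midLeft : ∀ r, q < r → r < i → f r j = .IIIa
  midRight : ∀ r, q < r → r < i → (f r (j + 1)).IsFull
  bottom : ((f q j = .I ∨ f q j = .IIa) ∧ (f q (j + 1) = .IIIb ∨ f q (j + 1) = .IIc)) ∨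
    ((f q j = .IIIa ∨ f q j = .IIb) ∧ f q (j + 1) = .IId)

/-- The array obtained by moving the vertical strand of a strip from column `j + 1` to column `j`. -/
def stripShift (f : ℤ → ℤ → Tile) (j q i : ℤ) : ℤ → ℤ → Tile := fun a b =>
  if b = j then
    if a = i then (f a b).topLeft else if a = q then (f a b).bottomLeft else
      if q < a ∧ a < i then f a (j + 1) else f a b
  else if b = j + 1 then
    if a = i then (f a b).topRight else if a = q then (f a b).bottomRight else
      if q < a ∧ a < i then .IIIa else f a b
  else f a b

section stripShift
variable {f : ℤ → ℤ → Tile} {j q i : ℤ}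

lemma stripShift_topLeft : stripShift f j q i i j = (f i j).topLeft := by simp [stripShift]

lemma stripShift_topRight : stripShift f j q i i (j + 1) = (f i (j + 1)).topRight := by
  simp [stripShift]

lemma stripShift_bottomLeft (h : q < i) : stripShift f j q i q j = (f q j).bottomLeft := by
  simp [stripShift, h.ne]

lemma stripShift_bottomRight (h : q < i) :
    stripShift f j q i q (j + 1) = (f q (j + 1)).bottomRight := by
  simp [stripShift, h.ne]

lemma stripShift_midLeft {r : ℤ} (h : q < r) (h' : r < i) :
    stripShift f j q i r j = f r (j + 1) := by
  simp [stripShift, h.ne', h'.ne, h, h']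

lemma stripShift_midRight {r : ℤ} (h : q < r) (h' : r < i) :
    stripShift f j q i r (j + 1) = .IIIa := by
  simp [stripShift, h.ne', h'.ne, h, h']

lemma stripShift_of_col {a b : ℤ} (h : ¬ (b = j ∨ b = j + 1)) : stripShift f j q i a b = f a b := by
  push Not at h
  simp [stripShift, h.1, h.2]

lemma stripShift_of_row {a b : ℤ} (hqi : q < i) (h : a < q ∨ i < a) :
    stripShift f j q i a b = f a b := by
  have h1 : a ≠ i := by omega
  have h2 : a ≠ q := by omega
  have h3 : ¬ (q < a ∧ a < i) := by omega
  simp [stripShift, h1, h2, h3]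

end stripShift

/-- The sides of the cell `(a, b)` whose use changes when a strip is shifted. -/
def stripFlip (j q i a b : ℤ) : Side → Prop
  | .left => b = j + 1 ∧ (a = i ∨ a = q)
  | .right => b = j ∧ (a = i ∨ a = q)
  | .bottom => (b = j ∨ b = j + 1) ∧ q < a ∧ a ≤ i
  | .top => (b = j ∨ b = j + 1) ∧ q ≤ a ∧ a < i

/-- A shift toggles exactly the cell sides crossed by the closed curve through the centres of the
cells of the strip. Each such side is toggled for both of its cells, which is why suitable
connectedness survives. -/
lemma IsStrip.uses_stripShift {f : ℤ → ℤ → Tile} {j q i : ℤ} (h : IsStrip f j q i) (a b : ℤ)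
    (s : Side) :
    (stripShift f j q i a b).Uses s ↔ ¬ ((f a b).Uses s ↔ stripFlip j q i a b s) := by
  have hlt := h.lt
  by_cases hb : b = j ∨ b = j + 1
  swap
  · rw [stripShift_of_col hb]
    have : ¬ stripFlip j q i a b s := by
      cases s <;> simp only [stripFlip] <;> omega
    tauto
  by_cases ha : a < q ∨ i < a
  · rw [stripShift_of_row hlt ha]
    have : ¬ stripFlip j q i a b s := by
      cases s <;> simp only [stripFlip] <;> omega
    tauto
  obtain rfl | rfl | ⟨ha1, ha2⟩ : a = i ∨ a = q ∨ (q < a ∧ a < i) := by omega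
  · have e : stripFlip j q a a b s ↔ (s = .bottom ∨ (b = j ∧ s = .right) ∨ (b = j + 1 ∧ s = .left)) := by
      cases s <;> simp [stripFlip] <;> omega
    rw [e]
    rcases hb with rfl | rfl
    · rw [stripShift_topLeft]
      rcases h.topLeft with e | e <;> rw [e] <;> cases s <;> simp <;> decide
    · rw [stripShift_topRight]
      rcases h.topRight with e | e <;> rw [e] <;> cases s <;> simp <;> decide
  · have e : stripFlip j a i a b s ↔ (s = .top ∨ (b = j ∧ s = .right) ∨ (b = j + 1 ∧ s = .left)) := by
      cases s <;> simp [stripFlip] <;> omega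
    rw [e]
    rcases hb with rfl | rfl
    · rw [stripShift_bottomLeft hlt]
      rcases h.bottom with ⟨e | e, -⟩ | ⟨e | e, -⟩ <;> rw [e] <;> cases s <;> simp <;> decide
    · rw [stripShift_bottomRight hlt]
      rcases h.bottom with ⟨-, e | e⟩ | ⟨-, e⟩ <;> rw [e] <;> cases s <;> simp <;> decide
  · have e : stripFlip j q i a b s ↔ (s = .top ∨ s = .bottom) := by
      cases s <;> simp [stripFlip] <;> omega
    rw [e]
    rcases hb with rfl | rfl
    · rw [stripShift_midLeft ha1 ha2, h.midLeft a ha1 ha2]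
      rcases h.midRight a ha1 ha2 with e | e | e | e <;> rw [e] <;> cases s <;> simp <;> decide
    · rw [stripShift_midRight ha1 ha2]
      rcases h.midRight a ha1 ha2 with e | e | e | e <;> rw [e] <;> cases s <;> simp <;> decide

lemma IsStrip.arrayConnected {f : ℤ → ℤ → Tile} {j q i : ℤ} (h : IsStrip f j q i)
    (hf : ArrayConnected f) : ArrayConnected (stripShift f j q i) := by
  intro a b
  rw [h.uses_stripShift, h.uses_stripShift, h.uses_stripShift, h.uses_stripShift, (hf a b).1,
    (hf a b).2]
  have e1 : stripFlip j q i a b .right ↔ stripFlip j q i a (b + 1) .left := by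
    simp only [stripFlip]; omega
  have e2 : stripFlip j q i a b .top ↔ stripFlip j q i (a + 1) b .bottom := by
    simp only [stripFlip]; omega
  rw [e1, e2]
  exact ⟨Iff.rfl, Iff.rfl⟩

/-- The strand is moved row by row from the top. In between, a jog on the line between two rows
connects its shifted upper part with its unshifted lower part. -/
lemma IsStrip.knotEquiv {f : ℤ → ℤ → Tile} {j q i : ℤ} (h : IsStrip f j q i)
    (hf : ArrayConnected f) : KnotEquiv (arrayLink f) (arrayLink (stripShift f j q i)) := by
  have hlt := h.lt
  set F := stripShift f j q i with hF
  -- `G k` is the intermediate stage: rows above k are already shifted, the others are untouched,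
  -- and the jog lies just above row k.
  let G : ℤ → ℤ → ℤ → Tile := fun k a b => if k < a then F a b else f a b
  have Gle : ∀ k a b, a ≤ k → G k a b = f a b := fun k a b hk => if_neg (by omega)
  have Ggt : ∀ k a b, k < a → G k a b = F a b := fun k a b hk => if_pos hk
  have step : ∀ k a b, ¬ (a = k ∧ (b = j ∨ b = j + 1)) → G (k - 1) a b = G k a b := by
    intro k a b hab
    rcases lt_trichotomy a k with hk | rfl | hk
    · rw [Gle _ _ _ (by omega), Gle _ _ _ (by omega)]
    · rw [Gle _ _ _ le_rfl, Ggt _ _ _ (by omega), hF, stripShift_of_col (by tauto)]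
    · rw [Ggt _ _ _ (by omega), Ggt _ _ _ (by omega)]
  have nobot : ∀ k, q ≤ k → k < i → ¬ (F (k + 1) (j + 1)).Uses .bottom := by
    intro k hk hk'
    obtain rfl | hki : i = k + 1 ∨ k + 1 < i := by omega
    · rw [hF, stripShift_topRight]
      rcases h.topRight with e | e <;> rw [e] <;> decide
    · rw [hF, stripShift_midRight (by omega) hki]; decide
  have shiftcol : j + 1 + 1 = j + 2 := by ring
  have hGi : G i = f := by
    funext a b
    by_cases ha : i < a
    · rw [Ggt _ _ _ ha, hF, stripShift_of_row hlt (Or.inr ha)]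
    · rw [Gle _ _ _ (by omega)]
  have hGq : G (q - 1) = F := by
    funext a b
    by_cases ha : q - 1 < a
    · rw [Ggt _ _ _ ha]
    · rw [Gle _ _ _ (by omega), hF, stripShift_of_row hlt (Or.inl (by omega))]
  have top : KnotEquiv (arrayLink f) (arrayLink (G (i - 1)) ∪ jog (i - 1) j) := by
    refine shift_top (fun a b hab => ?_) h.topLeft h.topRight ?_ ?_ ?_ ?_ ?_
    · rw [step i a b hab, hGi]
    · rw [Ggt _ _ _ (by omega), hF, stripShift_topLeft]
    · rw [Ggt _ _ _ (by omega), hF, stripShift_topRight]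
    · rw [← shiftcol]; exact (hf i (j + 1)).1.2
    · exact (hf i (j + 1)).2.2
    · intro h'
      have := (hf (i - 1) j).2.1 h'
      rw [sub_add_cancel] at this
      revert this
      rcases h.topLeft with e | e <;> rw [e] <;> decide
  have mid : ∀ m : ℕ, q < i - m → KnotEquiv (arrayLink f)
      (arrayLink (G (i - 1 - m)) ∪ jog (i - 1 - m) j) := by
    intro m
    induction m with
    | zero => intro _; simpa using top
    | succ m ih =>
      intro hm
      refine (ih (by push_cast at hm; omega)).trans ?_
      push_cast at hm ⊢
      obtain ⟨k, hk⟩ : ∃ k, k = i - 1 - (m : ℤ) := ⟨_, rfl⟩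
      rw [← hk, show i - 1 - ((m : ℤ) + 1) = k - 1 by omega]
      have hk1 : q < k := by omega
      have hk2 : k < i := by omega
      refine slide_row (step k) ?_ ?_ ?_ ?_ ?_ ?_
      · rw [Gle _ _ _ le_rfl]; exact h.midLeft k hk1 hk2
      · rw [Gle _ _ _ le_rfl]; exact h.midRight k hk1 hk2
      · rw [Gle _ _ _ le_rfl, Ggt _ _ _ (by omega), hF, stripShift_midLeft hk1 hk2]
      · rw [Ggt _ _ _ (by omega), hF, stripShift_midRight hk1 hk2]
      · rw [Ggt _ _ _ (by omega)]; exact nobot k hk1.le hk2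
      · rw [Gle _ _ _ (by omega)]
        intro h'
        have := (hf (k - 1) j).2.1 h'
        rw [sub_add_cancel, h.midLeft k hk1 hk2] at this
        revert this; decide
  -- After i - 1 - q further rows the jog lies just above row q, ready for the lower end.
  have hq := mid (i - 1 - q).toNat (by omega)
  rw [show i - 1 - ((i - 1 - q).toNat : ℤ) = q by omega] at hq
  refine hq.trans ?_
  rw [← hGq]
  have c1 : (G q q (j + 2)).Uses .left → (G q q (j + 1)).Uses .right := by
    rw [Gle _ _ _ le_rfl, Gle _ _ _ le_rfl, ← shiftcol]; exact (hf q (j + 1)).1.2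
  have c2 : ∀ b, (G q (q - 1) b).Uses .top → (G q q b).Uses .bottom := by
    intro b
    rw [Gle _ _ _ le_rfl, Gle _ _ _ (by omega)]
    intro h'
    simpa using (hf (q - 1) b).2.1 h'
  have c3 : ¬ (G q (q + 1) (j + 1)).Uses .bottom := by
    rw [Ggt _ _ _ (by omega)]; exact nobot q le_rfl hlt
  have c4 : (G q q (j - 1)).Uses .right → (G q q j).Uses .left := by
    rw [Gle _ _ _ le_rfl, Gle _ _ _ le_rfl]
    intro h'
    simpa using (hf q (j - 1)).1.1 h'
  have g1 : G (q - 1) q j = (G q q j).bottomLeft := by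
    rw [Gle _ _ _ le_rfl, Ggt _ _ _ (by omega), hF, stripShift_bottomLeft hlt]
  have g2 : G (q - 1) q (j + 1) = (G q q (j + 1)).bottomRight := by
    rw [Gle _ _ _ le_rfl, Ggt _ _ _ (by omega), hF, stripShift_bottomRight hlt]
  have hb := h.bottom
  rw [← Gle q q j le_rfl, ← Gle q q (j + 1) le_rfl] at hb
  rcases hb with ⟨hl, hr⟩ | ⟨hl, hr⟩
  · exact shift_bottom (step q) hl hr g1 g2 c1 (c2 _) c3
  · exact shift_bottom_turn (step q) hl hr g1 g2 c1 (c2 _) c3 c4 (c2 _)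


/-! ### Kinks -/

/-- The four cells around the upper right corner of the cell `(i, j)`, where an arc on `(i, j)` can be
given a kink running around that corner. -/
structure IsKinkSite (f : ℤ → ℤ → Tile) (i j : ℤ) : Prop where
  arc : f i j = .IIa
  right : f i (j + 1) = .I ∨ f i (j + 1) = .IIb
  above : f (i + 1) j = .I ∨ f (i + 1) j = .IId
  diagonal : f (i + 1) (j + 1) = .I ∨ f (i + 1) (j + 1) = .IIc

/-- An arc left-top is added. -/
def Tile.addLeftTop : Tile → Tile
  | .I => .IId
  | .IIb => .IVb
  | t => t

/-- An arc left-bottom is added. -/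
def Tile.addLeftBottom : Tile → Tile
  | .I => .IIa
  | .IIc => .IVa
  | t => t

/-- The array obtained by adding a kink. -/
def addKink (f : ℤ → ℤ → Tile) (i j : ℤ) : ℤ → ℤ → Tile := fun a b =>
  if a = i then if b = j then .Va else if b = j + 1 then (f a b).addLeftTop else f a b
  else if a = i + 1 then
    if b = j then (f a b).topLeft else if b = j + 1 then (f a b).addLeftBottom else f a b
  else f a b

section addKink
variable {f : ℤ → ℤ → Tile} {i j : ℤ}

lemma addKink_arc : addKink f i j i j = .Va := by simp [addKink]

lemma addKink_right : addKink f i j i (j + 1) = (f i (j + 1)).addLeftTop := by simp [addKink]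

lemma addKink_above : addKink f i j (i + 1) j = (f (i + 1) j).topLeft := by simp [addKink]

lemma addKink_diagonal : addKink f i j (i + 1) (j + 1) = (f (i + 1) (j + 1)).addLeftBottom := by
  simp [addKink]

lemma addKink_of_off {a b : ℤ} (h : ¬ ((a = i ∨ a = i + 1) ∧ (b = j ∨ b = j + 1))) :
    addKink f i j a b = f a b := by
  unfold addKink
  split_ifs <;> first | rfl | (exfalso; omega)

/-- A kink toggles the four cell sides meeting at the vertex that it encircles, each for both of its
cells. -/
lemma IsKinkSite.uses_addKink (h : IsKinkSite f i j) (a b : ℤ) (s : Side) :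
    (addKink f i j a b).Uses s ↔ ¬ ((f a b).Uses s ↔
      ((s = .right ∧ b = j ∧ (a = i ∨ a = i + 1)) ∨ (s = .left ∧ b = j + 1 ∧ (a = i ∨ a = i + 1)) ∨
       (s = .top ∧ a = i ∧ (b = j ∨ b = j + 1)) ∨
       (s = .bottom ∧ a = i + 1 ∧ (b = j ∨ b = j + 1)))) := by
  by_cases hab : (a = i ∨ a = i + 1) ∧ (b = j ∨ b = j + 1)
  swap
  · rw [addKink_of_off hab]
    have : ¬ ((s = .right ∧ b = j ∧ (a = i ∨ a = i + 1)) ∨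
        (s = .left ∧ b = j + 1 ∧ (a = i ∨ a = i + 1)) ∨
        (s = .top ∧ a = i ∧ (b = j ∨ b = j + 1)) ∨
        (s = .bottom ∧ a = i + 1 ∧ (b = j ∨ b = j + 1))) := by omega
    tauto
  obtain ⟨rfl | rfl, rfl | rfl⟩ := hab
  · rw [addKink_arc, h.arc]; cases s <;> simp <;> decide
  · rw [addKink_right]
    rcases h.right with e | e <;> rw [e] <;> cases s <;> simp <;> decide
  · rw [addKink_above]
    rcases h.above with e | e <;> rw [e] <;> cases s <;> simp <;> decide
  · rw [addKink_diagonal]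
    rcases h.diagonal with e | e <;> rw [e] <;> cases s <;> simp <;> decide

lemma IsKinkSite.arrayConnected (h : IsKinkSite f i j) (hf : ArrayConnected f) :
    ArrayConnected (addKink f i j) := by
  intro a b
  rw [h.uses_addKink, h.uses_addKink, h.uses_addKink, h.uses_addKink, (hf a b).1, (hf a b).2]
  simp

/-- The part of `arrayLink f` outside the four cells around the upper right corner of `(i, j)`. -/
def offFace (f : ℤ → ℤ → Tile) (i j : ℤ) : Set (Fin 3 → ℝ) :=
  {x | ∃ a b, ¬ ((a = i ∨ a = i + 1) ∧ (b = j ∨ b = j + 1)) ∧ x ∈ cellSet a b (f a b)}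

lemma arrayLink_eq_face (f : ℤ → ℤ → Tile) (i j : ℤ) :
    arrayLink f = offFace f i j ∪ (cellSet i j (f i j) ∪ (cellSet i (j + 1) (f i (j + 1)) ∪
      (cellSet (i + 1) j (f (i + 1) j) ∪ cellSet (i + 1) (j + 1) (f (i + 1) (j + 1))))) := by
  ext x
  constructor
  · rintro ⟨a, b, hx⟩
    by_cases h : (a = i ∨ a = i + 1) ∧ (b = j ∨ b = j + 1)
    · obtain ⟨rfl | rfl, rfl | rfl⟩ := h
      · exact Or.inr (Or.inl hx)
      · exact Or.inr (Or.inr (Or.inl hx))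
      · exact Or.inr (Or.inr (Or.inr (Or.inl hx)))
      · exact Or.inr (Or.inr (Or.inr (Or.inr hx)))
    · exact Or.inl ⟨a, b, h, hx⟩
  · rintro (⟨a, b, -, hx⟩ | hx | hx | hx | hx)
    exacts [⟨a, b, hx⟩, ⟨_, _, hx⟩, ⟨_, _, hx⟩, ⟨_, _, hx⟩, ⟨_, _, hx⟩]

lemma offFace_congr {g : ℤ → ℤ → Tile}
    (h : ∀ a b, ¬ ((a = i ∨ a = i + 1) ∧ (b = j ∨ b = j + 1)) → g a b = f a b) :
    offFace g i j = offFace f i j := by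
  ext x
  constructor <;> rintro ⟨a, b, hab, hx⟩ <;> refine ⟨a, b, hab, ?_⟩
  · rwa [h a b hab] at hx
  · rwa [h a b hab]

/-- The inequalities cut out the tilted rectangle with corners (-1, 0), (0, -1), (2, 1), (1, 2) in
local coordinates, over which all triangles of `add_kink` lie. The diamonds of outer cells reach it
only at the two ends of the original arc. -/
lemma offFace_contact {x : Fin 3 → ℝ} (hx : x ∈ offFace f i j)
    (h1 : (2 * j : ℝ) + 2 * i - 1 ≤ x 0 + x 1) (h2 : x 0 + x 1 ≤ 2 * j + 2 * i + 3)
    (h3 : (2 * j : ℝ) - 2 * i - 1 ≤ x 0 - x 1) (h4 : x 0 - x 1 ≤ 2 * j - 2 * i + 1) :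
    (x 0 = 2 * j - 1 ∧ x 1 = 2 * i) ∨ (x 0 = 2 * j ∧ x 1 = 2 * i - 1) := by
  obtain ⟨a, b, hab, hx⟩ := hx
  obtain ⟨a, rfl⟩ : ∃ c, a = i + c := ⟨a - i, by ring⟩
  obtain ⟨b, rfl⟩ : ∃ c, b = j + c := ⟨b - j, by ring⟩
  obtain ⟨⟨d1, d2, d3, d4⟩, -⟩ := cellSet_diamond hx
  push_cast at d1 d2 d3 d4
  have a1 : a < 2 := by
    have : (a : ℝ) < 2 := by linarith
    exact_mod_cast this
  have a2 : -2 < a := by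
    have : (-2 : ℝ) < a := by linarith
    exact_mod_cast this
  have b1 : b < 2 := by
    have : (b : ℝ) < 2 := by linarith
    exact_mod_cast this
  have b2 : -2 < b := by
    have : (-2 : ℝ) < b := by linarith
    exact_mod_cast this
  interval_cases a <;> interval_cases b <;> norm_num at d1 d2 d3 d4 hab
  · exfalso; linarith
  · exact Or.inr ⟨by linarith, by linarith⟩
  · exfalso; linarith
  · exact Or.inl ⟨by linarith, by linarith⟩
  · exfalso; linarith

lemma IsKinkSite.knotEquiv (h : IsKinkSite f i j) :
    KnotEquiv (arrayLink f) (arrayLink (addKink f i j)) := by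
  rw [arrayLink_eq_face f i j, arrayLink_eq_face (addKink f i j) i j,
    offFace_congr fun a b hab => addKink_of_off hab, addKink_arc, addKink_right, addKink_above,
    addKink_diagonal]
  have e1 : cellSet i (j + 1) (f i (j + 1)).addLeftTop =
      cellSet i (j + 1) (f i (j + 1)) ∪ seg (2 * j) (2 * i) 1 0 0 2 1 0 := by
    rcases h.right with e | e <;> rw [e] <;>
      simp only [Tile.addLeftTop, cellSet_I, cellSet_IIb, cellSet_IVb, cellSet_IId,
        Set.empty_union, two_mul_cast_succ, seg_add_right, add_zero, two_add_neg_one]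
  have e2 : cellSet (i + 1) j (f (i + 1) j).topLeft =
      cellSet (i + 1) j (f (i + 1) j) ∪ seg (2 * j) (2 * i) 0 1 0 1 2 0 := by
    rcases h.above with e | e <;> rw [e] <;>
      simp only [Tile.topLeft, cellSet_I, cellSet_IIb, cellSet_IVb, cellSet_IId,
        Set.empty_union, two_mul_cast_succ, seg_add_up, add_zero, two_add_neg_one]
    exact Set.union_comm _ _
  have e3 : cellSet (i + 1) (j + 1) (f (i + 1) (j + 1)).addLeftBottom =
      cellSet (i + 1) (j + 1) (f (i + 1) (j + 1)) ∪ seg (2 * j) (2 * i) 1 2 0 2 1 0 := by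
    rcases h.diagonal with e | e <;> rw [e] <;>
      simp only [Tile.addLeftBottom, cellSet_I, cellSet_IIc, cellSet_IVa, cellSet_IIa,
        Set.empty_union, two_mul_cast_succ, seg_add_right, seg_add_up, add_zero, two_add_neg_one]
    exact Set.union_comm _ _
  rw [e1, e2, e3, h.arc, cellSet_IIa, cellSet_Va]
  have hC : ∀ x ∈ offFace f i j ∪ (cellSet i (j + 1) (f i (j + 1)) ∪
      (cellSet (i + 1) j (f (i + 1) j) ∪ cellSet (i + 1) (j + 1) (f (i + 1) (j + 1)))),
      (2 * j : ℝ) + 2 * i - 1 ≤ x 0 + x 1 → x 0 + x 1 ≤ 2 * j + 2 * i + 3 →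
      (2 * j : ℝ) - 2 * i - 1 ≤ x 0 - x 1 → x 0 - x 1 ≤ 2 * j - 2 * i + 1 →
      (x 0 = 2 * j - 1 ∧ x 1 = 2 * i) ∨ (x 0 = 2 * j ∧ x 1 = 2 * i - 1) := by
    rintro x (hx | hx | hx | hx) h1 h2 h3 h4
    · exact offFace_contact hx h1 h2 h3 h4
    all_goals exfalso
    · rcases h.right with e | e <;> rw [e] at hx
      · rwa [cellSet_I] at hx
      · rw [cellSet_IIb] at hx
        obtain ⟨s, hs0, hs1, e0, e1, -⟩ := mem_seg hx
        push_cast at e0 e1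
        linarith
    · rcases h.above with e | e <;> rw [e] at hx
      · rwa [cellSet_I] at hx
      · rw [cellSet_IId] at hx
        obtain ⟨s, hs0, hs1, e0, e1, -⟩ := mem_seg hx
        push_cast at e0 e1
        linarith
    · rcases h.diagonal with e | e <;> rw [e] at hx
      · rwa [cellSet_I] at hx
      · rw [cellSet_IIc] at hx
        obtain ⟨s, hs0, hs1, e0, e1, -⟩ := mem_seg hx
        push_cast at e0 e1
        linarith
  exact (KnotEquiv.of_eq (by ac_rfl)).trans ((add_kink hC).trans (KnotEquiv.of_eq (by ac_rfl)))

end addKink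


/-! ### The triple T as a cost of mosaics -/

/-- The number of the three components of the triple `T` to which the dual of a tile contributes. -/
def Tile.rank : Tile → ℕ
  | .I => 3
  | .IVa => 1
  | .IVb => 1
  | .Va => 0
  | .Vb => 0
  | _ => 2

/-- The number of cells of `S` whose tile has rank at least `k`. -/
noncomputable def rankCount (n k : ℕ) (f : ℤ → ℤ → Tile) : ℕ :=
  {c ∈ interior n | k ≤ (f c.1 c.2).rank}.card

/-- The triple `T` of the duals of a mosaic, in terms of the mosaic. -/
noncomputable def cost (n : ℕ) (f : ℤ → ℤ → Tile) : ℕ ×ₗ (ℕ ×ₗ ℕ) :=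
  toLex (rankCount n 1 f, toLex (rankCount n 2 f, rankCount n 3 f))

/-- Crossings become blank, type IV becomes type 0, and exactly the blanks become type IV; the
choice between `IVa` and `IVb` changes none of the counts. -/
lemma IsDual.triple_eq {n : ℕ} {M : Mosaic n} {D : DualArray} (h : IsDual M D) :
    D.triple n = cost n M.tile := by
  have key : ∀ c ∈ interior n, (D c.1 c.2 ≠ .I ↔ 1 ≤ (M.tile c.1 c.2).rank) ∧
      (D c.1 c.2 ≠ .I ∧ D c.1 c.2 ≠ .O ↔ 2 ≤ (M.tile c.1 c.2).rank) ∧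
      ((D c.1 c.2).IsIV ↔ 3 ≤ (M.tile c.1 c.2).rank) := by
    intro c hc
    have := (h c.1 c.2).1 hc
    generalize M.tile c.1 c.2 = R at this
    generalize D c.1 c.2 = T at this
    cases this <;> decide
  simp only [DualArray.triple, cost, DualArray.size, DualArray.size', DualArray.size'', rankCount]
  rw [Finset.filter_congr fun c hc => (key c hc).1, Finset.filter_congr fun c hc => (key c hc).2.1,
    Finset.filter_congr fun c hc => (key c hc).2.2]

lemma exists_isDual {n : ℕ} (M : Mosaic n) : ∃ D, IsDual M D := by
  have : ∀ R : Tile, ∃ T, TileDual R T := by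
    intro R
    cases R
    exacts [⟨_, .Ia⟩, ⟨_, .IIa⟩, ⟨_, .IIb⟩, ⟨_, .IIc⟩, ⟨_, .IId⟩, ⟨_, .IIIa⟩, ⟨_, .IIIb⟩, ⟨_, .IVa⟩,
      ⟨_, .IVb⟩, ⟨_, .Va⟩, ⟨_, .Vb⟩]
  choose d hd using this
  refine ⟨fun i j => if (i, j) ∈ interior n then d (M.tile i j) else .I, fun i j => ⟨fun h => ?_,
    fun h => ?_⟩⟩
  · simpa only [if_pos h] using hd _
  · simp only [if_neg h]

/-- An injection of S into itself along which ranks do not rise makes each of the three counts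
weakly smaller. A strict drop at one cell makes one of them strictly smaller, hence also the
lexicographic triple. -/
lemma cost_lt {n : ℕ} {f g : ℤ → ℤ → Tile} (σ : ℤ × ℤ → ℤ × ℤ) (hσ : Function.Injective σ)
    (hint : ∀ c ∈ interior n, σ c ∈ interior n)
    (hle : ∀ c ∈ interior n, (g c.1 c.2).rank ≤ (f (σ c).1 (σ c).2).rank)
    (c₀ : ℤ × ℤ) (h₀ : c₀ ∈ interior n) (hlt : (g c₀.1 c₀.2).rank < (f (σ c₀).1 (σ c₀).2).rank) :
    cost n g < cost n f := by
  have hmaps : ∀ k, Set.MapsTo σ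
      ({c ∈ interior n | k ≤ (f (σ c).1 (σ c).2).rank} : Finset (ℤ × ℤ))
      ({c ∈ interior n | k ≤ (f c.1 c.2).rank} : Finset (ℤ × ℤ)) := by
    intro k c hc
    simp only [Finset.coe_filter, Set.mem_ofPred_eq] at hc ⊢
    exact ⟨hint c hc.1, hc.2⟩
  have hcard : ∀ k, ({c ∈ interior n | k ≤ (f (σ c).1 (σ c).2).rank} : Finset (ℤ × ℤ)).card ≤
      rankCount n k f := fun k => Finset.card_le_card_of_injOn σ (hmaps k) hσ.injOn
  have hsub : ∀ k, ({c ∈ interior n | k ≤ (g c.1 c.2).rank} : Finset (ℤ × ℤ)) ⊆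
      {c ∈ interior n | k ≤ (f (σ c).1 (σ c).2).rank} := by
    intro k c hc
    rw [Finset.mem_filter] at hc ⊢
    exact ⟨hc.1, hc.2.trans (hle c hc.1)⟩
  have hmono : ∀ k, rankCount n k g ≤ rankCount n k f := fun k =>
    (Finset.card_le_card (hsub k)).trans (hcard k)
  have hstrict : ∀ k, (g c₀.1 c₀.2).rank < k → k ≤ (f (σ c₀).1 (σ c₀).2).rank →
      rankCount n k g < rankCount n k f := by
    intro k h1 h2
    refine lt_of_lt_of_le (Finset.card_lt_card ?_) (hcard k)
    refine (Finset.ssubset_iff_of_subset (hsub k)).2 ⟨c₀, ?_, ?_⟩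
    · rw [Finset.mem_filter]; exact ⟨h₀, h2⟩
    · rw [Finset.mem_filter]; omega
  have h1 := hmono 1
  have h2 := hmono 2
  have h3 := hmono 3
  -- The count that drops strictly is the one whose threshold is the old rank at `σ c₀`.
  have : rankCount n 1 g < rankCount n 1 f ∨ rankCount n 2 g < rankCount n 2 f ∨
      rankCount n 3 g < rankCount n 3 f := by
    have hr : (f (σ c₀).1 (σ c₀).2).rank ≤ 3 := by
      generalize f (σ c₀).1 (σ c₀).2 = t
      cases t <;> decide
    obtain h | h | h : (f (σ c₀).1 (σ c₀).2).rank = 1 ∨ (f (σ c₀).1 (σ c₀).2).rank = 2 ∨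
      (f (σ c₀).1 (σ c₀).2).rank = 3 := by omega
    · exact Or.inl (hstrict 1 (by omega) (by omega))
    · exact Or.inr (Or.inl (hstrict 2 (by omega) (by omega)))
    · exact Or.inr (Or.inr (hstrict 3 (by omega) (by omega)))
  simp only [cost, Prod.Lex.toLex_lt_toLex]
  omega

/-- A nonempty link mosaic whose triple `T` is least among all mosaics of the same size for its
link. -/
structure IsCheapest {n : ℕ} (M : Mosaic n) : Prop where
  connected : ArrayConnected M.tile
  nonempty : (arrayLink M.tile).Nonempty
  cost_le : ∀ M' : Mosaic n, ArrayConnected M'.tile →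
    KnotEquiv (arrayLink M.tile) (arrayLink M'.tile) → cost n M.tile ≤ cost n M'.tile

lemma IsMinimalEmbedding.isCheapest {n : ℕ} {M : Mosaic n} {D : DualArray}
    (h : IsMinimalEmbedding M D) : IsCheapest M where
  connected := h.isKnotMosaic.1
  nonempty := h.isKnotMosaic.2.nonempty
  cost_le M' h1 h2 := by
    obtain ⟨D', hD'⟩ := exists_isDual M'
    rw [← h.isDual.triple_eq, ← hD'.triple_eq]
    exact h.tMinimal M' D' ⟨h1, h2.symm⟩ hD'

lemma mem_interior {n : ℕ} {i j : ℤ} :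
    (i, j) ∈ interior n ↔ (2 ≤ i ∧ i ≤ n - 1) ∧ 2 ≤ j ∧ j ≤ n - 1 := by
  simp [interior]

/-- In a cheapest mosaic there is no strip whose shift would lower the triple `T`. -/
lemma IsCheapest.not_isStrip {n : ℕ} {M : Mosaic n} (hM : IsCheapest M) {j q i : ℤ}
    (h : IsStrip M.tile j q i) (hq : 1 ≤ q) (hi : i ≤ n) (hj : 1 ≤ j) (hj' : j + 1 ≤ n)
    (hmid : q + 1 < i → 2 ≤ j ∧ j + 1 ≤ n - 1)
    (hint : (i, j) ∈ interior n ∨ (q, j) ∈ interior n ∧ ¬ M.tile q (j + 1) = .IId)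
    (hturn : M.tile q (j + 1) = .IId → (q, j + 1) ∉ interior n) : False := by
  have hlt := h.lt
  let M' : Mosaic n :=
    { tile := stripShift M.tile j q i
      blank_outside := by
        intro a b hab
        by_cases hb : b = j ∨ b = j + 1
        · rw [stripShift_of_row hlt (by omega)]
          exact M.blank_outside a b hab
        · rw [stripShift_of_col hb]
          exact M.blank_outside a b hab }
  refine absurd (hM.cost_le M' (h.arrayConnected hM.connected) (h.knotEquiv hM.connected)) ?_
  rw [not_le]
  -- In the middle rows full tiles and horizontal segments trade columns, so new ranks are compared
  -- with old ones after swapping the columns there; `hmid` keeps this swap inside S.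
  let σ : ℤ × ℤ → ℤ × ℤ := fun c => if q < c.1 ∧ c.1 < i then
    (if c.2 = j then (c.1, j + 1) else if c.2 = j + 1 then (c.1, j) else c) else c
  have hσ_end : ∀ a b, a = i ∨ a = q → σ (a, b) = (a, b) := by
    intro a b hab
    exact if_neg (by simp only; omega)
  have hTL : (M.tile i j).topLeft.rank < (M.tile i j).rank := by
    rcases h.topLeft with e | e <;> rw [e] <;> decide
  have hBL : (M.tile q j).bottomLeft.rank ≤ (M.tile q j).rank := by
    rcases h.bottom with ⟨e | e, -⟩ | ⟨e | e, -⟩ <;> rw [e] <;> decide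
  have hσinj : Function.Injective σ := by
    rintro ⟨a, b⟩ ⟨a', b'⟩ hab
    simp only [σ] at hab
    split_ifs at hab <;> simp only [Prod.mk.injEq] at hab ⊢ <;> omega
  have hσint : ∀ c ∈ interior n, σ c ∈ interior n := by
    rintro ⟨a, b⟩ hc
    simp only [σ]
    split_ifs <;> rw [mem_interior] at * <;> omega
  have hle : ∀ c ∈ interior n, (M'.tile c.1 c.2).rank ≤ (M.tile (σ c).1 (σ c).2).rank := by
    rintro ⟨a, b⟩ hc
    change (stripShift M.tile j q i a b).rank ≤ _
    by_cases hb : b = j ∨ b = j + 1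
    swap
    · have : σ (a, b) = (a, b) := by
        simp only [σ]; split_ifs <;> first | rfl | (exfalso; omega)
      rw [stripShift_of_col hb, this]
    by_cases ha : a < q ∨ i < a
    · rw [stripShift_of_row hlt ha]
      have : σ (a, b) = (a, b) := if_neg (by simp only; omega)
      rw [this]
    obtain rfl | rfl | ⟨ha1, ha2⟩ : a = i ∨ a = q ∨ (q < a ∧ a < i) := by omega
    · rw [hσ_end _ _ (Or.inl rfl)]
      rcases hb with rfl | rfl
      · rw [stripShift_topLeft]; exact hTL.le
      · rw [stripShift_topRight]
        rcases h.topRight with e | e <;> simp only [e] <;> decide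
    · rw [hσ_end _ _ (Or.inr rfl)]
      rcases hb with rfl | rfl
      · rw [stripShift_bottomLeft hlt]; exact hBL
      · rw [stripShift_bottomRight hlt]
        rcases h.bottom with ⟨-, e | e⟩ | ⟨-, e⟩
        · simp only [e]; decide
        · simp only [e]; decide
        -- Here `IId` becomes blank and its rank rises, which does no harm only because the cell
        -- lies outside S.
        · exact absurd hc (hturn e)
    · rcases hb with rfl | rfl
      · have : σ (a, b) = (a, b + 1) := by simp [σ, ha1, ha2]
        rw [stripShift_midLeft ha1 ha2, this]
      · have : σ (a, j + 1) = (a, j) := by simp [σ, ha1, ha2]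
        rw [stripShift_midRight ha1 ha2, this]
        simp only [h.midLeft a ha1 ha2, le_refl]
  rcases hint with hint | ⟨hint, hne⟩
  · refine cost_lt σ hσinj hσint hle (i, j) hint ?_
    change (stripShift M.tile j q i i j).rank < _
    rw [hσ_end _ _ (Or.inl rfl), stripShift_topLeft]
    exact hTL
  · refine cost_lt σ hσinj hσint hle (q, j) hint ?_
    change (stripShift M.tile j q i q j).rank < _
    rw [hσ_end _ _ (Or.inr rfl), stripShift_bottomLeft hlt]
    rcases h.bottom with ⟨e | e, -⟩ | ⟨-, e⟩
    · simp only [e]; decide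
    · simp only [e]; decide
    · exact absurd e hne

lemma IsCheapest.not_isKinkSite {n : ℕ} {M : Mosaic n} (hM : IsCheapest M) {i j : ℤ}
    (h : IsKinkSite M.tile i j) (hint : (i, j) ∈ interior n) : False := by
  rw [mem_interior] at hint
  let M' : Mosaic n :=
    { tile := addKink M.tile i j
      blank_outside := by
        intro a b hab
        rw [addKink_of_off (by omega)]
        exact M.blank_outside a b hab }
  refine absurd (hM.cost_le M' (h.arrayConnected hM.connected) h.knotEquiv) ?_
  rw [not_le]
  refine cost_lt id Function.injective_id (fun c hc => hc) ?_ (i, j) (mem_interior.2 hint) ?_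
  · rintro ⟨a, b⟩ -
    change (addKink M.tile i j a b).rank ≤ (M.tile a b).rank
    by_cases hab : (a = i ∨ a = i + 1) ∧ (b = j ∨ b = j + 1)
    swap
    · rw [addKink_of_off hab]
    obtain ⟨rfl | rfl, rfl | rfl⟩ := hab
    · rw [addKink_arc, h.arc]; decide
    · rw [addKink_right]; rcases h.right with e | e <;> rw [e] <;> decide
    · rw [addKink_above]; rcases h.above with e | e <;> rw [e] <;> decide
    · rw [addKink_diagonal]; rcases h.diagonal with e | e <;> rw [e] <;> decide
  · change (addKink M.tile i j i j).rank < (M.tile i j).rank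
    rw [addKink_arc, h.arc]; decide


/-! ### Reflections -/

lemma KnotEquiv.image {K L : Set (Fin 3 → ℝ)} (h : KnotEquiv K L)
    (e : (Fin 3 → ℝ) →ᵃ[ℝ] (Fin 3 → ℝ)) (he : Function.Injective e) :
    KnotEquiv (e '' K) (e '' L) := by
  induction h with
  | rel K L h =>
    obtain ⟨a, b, c, hi, hK, rfl⟩ := h
    refine Relation.EqvGen.rel _ _ ⟨e a, e b, e c, ?_, ?_, ?_⟩
    · have := hi.map' e he
      have e1 : e ∘ ![a, b, c] = ![e a, e b, e c] := by
        funext k; fin_cases k <;> rfl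
      rwa [e1] at this
    · rw [← image_segment ℝ e a b, ← hK, Set.image_inter he, AffineMap.image_convexHull,
        Set.image_insert_eq, Set.image_pair]
    · rw [Set.image_union, Set.image_union, Set.image_sdiff he, image_segment, image_segment,
        image_segment]
  | refl K => exact KnotEquiv.refl _
  | symm K L _ ih => exact ih.symm
  | trans K L N _ _ ih1 ih2 => exact ih1.trans ih2

/-- The reflection of a tile in the diagonal. -/
def Tile.tr : Tile → Tile
  | .IIb => .IId
  | .IId => .IIb
  | .IIIa => .IIIb
  | .IIIb => .IIIa
  | .Va => .Vb
  | .Vb => .Va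
  | t => t

/-- The reflection of a tile in the vertical axis. -/
def Tile.mirror : Tile → Tile
  | .IIa => .IIb
  | .IIb => .IIa
  | .IIc => .IId
  | .IId => .IIc
  | .IVa => .IVb
  | .IVb => .IVa
  | t => t

lemma Tile.tr_tr (t : Tile) : t.tr.tr = t := by cases t <;> rfl
lemma Tile.mirror_mirror (t : Tile) : t.mirror.mirror = t := by cases t <;> rfl
lemma Tile.rank_tr (t : Tile) : t.tr.rank = t.rank := by cases t <;> rfl
lemma Tile.rank_mirror (t : Tile) : t.mirror.rank = t.rank := by cases t <;> rfl

lemma Tile.uses_tr (t : Tile) : (t.tr.Uses .left ↔ t.Uses .bottom) ∧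
    (t.tr.Uses .bottom ↔ t.Uses .left) ∧ (t.tr.Uses .right ↔ t.Uses .top) ∧
    (t.tr.Uses .top ↔ t.Uses .right) := by cases t <;> decide

lemma Tile.uses_mirror (t : Tile) : (t.mirror.Uses .left ↔ t.Uses .right) ∧
    (t.mirror.Uses .right ↔ t.Uses .left) ∧ (t.mirror.Uses .bottom ↔ t.Uses .bottom) ∧
    (t.mirror.Uses .top ↔ t.Uses .top) := by cases t <;> decide

/-- The transpose of an array of tiles. -/
def arrayTr (f : ℤ → ℤ → Tile) : ℤ → ℤ → Tile := fun i j => (f j i).tr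

/-- The mirror image of an `n × n` array of tiles in the vertical axis. -/
def arrayMirror (n : ℕ) (f : ℤ → ℤ → Tile) : ℤ → ℤ → Tile := fun i j => (f i (n + 1 - j)).mirror

lemma ArrayConnected.tr {f : ℤ → ℤ → Tile} (hf : ArrayConnected f) :
    ArrayConnected (arrayTr f) := by
  intro i j
  simp only [arrayTr, (Tile.uses_tr _).1, (Tile.uses_tr _).2.1, (Tile.uses_tr _).2.2.1,
    (Tile.uses_tr _).2.2.2]
  exact (hf j i).symm

lemma ArrayConnected.mirror {f : ℤ → ℤ → Tile} (hf : ArrayConnected f) (n : ℕ) :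
    ArrayConnected (arrayMirror n f) := by
  intro i j
  simp only [arrayMirror, (Tile.uses_mirror _).1, (Tile.uses_mirror _).2.1,
    (Tile.uses_mirror _).2.2.1, (Tile.uses_mirror _).2.2.2]
  refine ⟨?_, (hf i _).2⟩
  rw [show (n : ℤ) + 1 - j = n + 1 - (j + 1) + 1 by ring]
  exact (hf i _).1.symm

/-- The reflection of space that exchanges the first two coordinates. -/
def swapMap : (Fin 3 → ℝ) →ᵃ[ℝ] (Fin 3 → ℝ) :=
  (LinearMap.funLeft ℝ ℝ (Equiv.swap (0 : Fin 3) 1)).toAffineMap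

lemma swapMap_apply (x : Fin 3 → ℝ) (k : Fin 3) : swapMap x k = x (Equiv.swap 0 1 k) := rfl

lemma swapMap_swapMap (x : Fin 3 → ℝ) : swapMap (swapMap x) = x := by
  funext k; simp [swapMap_apply]

lemma swapMap_injective : Function.Injective swapMap :=
  Function.LeftInverse.injective swapMap_swapMap

/-- The reflection of space that maps the first coordinate `x` to `s - x`. -/
def mirrorMap (s : ℝ) : (Fin 3 → ℝ) →ᵃ[ℝ] (Fin 3 → ℝ) :=
  (LinearMap.pi fun k => (if k = 0 then -1 else 1 : ℝ) • LinearMap.proj k).toAffineMap +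
    AffineMap.const ℝ _ ![s, 0, 0]

lemma mirrorMap_zero (s : ℝ) (x : Fin 3 → ℝ) : mirrorMap s x 0 = s - x 0 := by
  simp [mirrorMap]; ring

lemma mirrorMap_one (s : ℝ) (x : Fin 3 → ℝ) : mirrorMap s x 1 = x 1 := by
  simp [mirrorMap]

lemma mirrorMap_two (s : ℝ) (x : Fin 3 → ℝ) : mirrorMap s x 2 = x 2 := by
  simp [mirrorMap]

lemma mirrorMap_mirrorMap (s : ℝ) (x : Fin 3 → ℝ) : mirrorMap s (mirrorMap s x) = x := by
  funext k
  fin_cases k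
  · change mirrorMap s (mirrorMap s x) 0 = x 0
    rw [mirrorMap_zero, mirrorMap_zero]; ring
  · change mirrorMap s (mirrorMap s x) 1 = x 1
    rw [mirrorMap_one, mirrorMap_one]
  · change mirrorMap s (mirrorMap s x) 2 = x 2
    rw [mirrorMap_two, mirrorMap_two]

lemma mirrorMap_injective (s : ℝ) : Function.Injective (mirrorMap s) :=
  Function.LeftInverse.injective (mirrorMap_mirrorMap s)

lemma swapMap_image_seg (X Y a b c a' b' c' : ℝ) :
    swapMap '' seg X Y a b c a' b' c' = seg Y X b a c b' a' c' := by
  have : ∀ a b c, swapMap (pt X Y a b c) = pt Y X b a c := fun a b c =>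
    eq_pt_iff.2 ⟨rfl, rfl, rfl⟩
  rw [seg, image_segment, this, this, seg]

lemma mirrorMap_image_seg (s X Y a b c a' b' c' : ℝ) :
    mirrorMap s '' seg X Y a b c a' b' c' = seg (s - X) Y (-a) b c (-a') b' c' := by
  have : ∀ a b c, mirrorMap s (pt X Y a b c) = pt (s - X) Y (-a) b c := fun a b c =>
    eq_pt_iff.2 ⟨by rw [mirrorMap_zero, pt_zero]; ring, by rw [mirrorMap_one, pt_one],
      by rw [mirrorMap_two, pt_two]⟩
  rw [seg, image_segment, this, this, seg]

lemma swapMap_image_cellSet (i j : ℤ) (t : Tile) :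
    swapMap '' cellSet i j t = cellSet j i t.tr := by
  cases t <;> simp only [Tile.tr, cellSet_I, cellSet_IIa, cellSet_IIb, cellSet_IIc, cellSet_IId,
    cellSet_IIIa, cellSet_IIIb, cellSet_IVa, cellSet_IVb, cellSet_Va, cellSet_Vb,
    Set.image_empty, Set.image_union, swapMap_image_seg]
  · rw [seg_symm]
  · rw [seg_symm]
  · rw [seg_symm, seg_symm _ _ 0 1]
  · rw [Set.union_comm]
  · rw [Set.union_comm]
  · rw [Set.union_comm]

lemma mirrorMap_image_cellSet (s i j : ℤ) (t : Tile) :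
    mirrorMap (2 * s) '' cellSet i j t = cellSet i (s - j) t.mirror := by
  have e : (2 : ℝ) * ((s - j : ℤ) : ℝ) = 2 * s - 2 * j := by push_cast; ring
  cases t <;> simp only [Tile.mirror, cellSet_I, cellSet_IIa, cellSet_IIb, cellSet_IIc, cellSet_IId,
    cellSet_IIIa, cellSet_IIIb, cellSet_IVa, cellSet_IVb, cellSet_Va, cellSet_Vb,
    Set.image_empty, Set.image_union, mirrorMap_image_seg, e, neg_neg, neg_zero]
  · rw [seg_symm]
  · rw [seg_symm]
  · rw [seg_symm]
  · rw [seg_symm _ _ 1 0 0 0 (-1) 0]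
  · rw [seg_symm _ _ 0 (-1) 0 (-1) 0 0]
  · rw [seg_symm _ _ 1 0 0 0 0 1, seg_symm _ _ 0 0 1 (-1) 0 0, Set.union_comm (seg _ _ 0 0 1 1 0 0)]
  · rw [seg_symm]

lemma arrayLink_arrayTr (f : ℤ → ℤ → Tile) : arrayLink (arrayTr f) = swapMap '' arrayLink f := by
  ext x
  constructor
  · rintro ⟨i, j, hx⟩
    rw [arrayTr, ← swapMap_image_cellSet] at hx
    obtain ⟨y, hy, rfl⟩ := hx
    exact ⟨y, ⟨j, i, hy⟩, rfl⟩
  · rintro ⟨y, ⟨i, j, hy⟩, rfl⟩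
    refine ⟨j, i, ?_⟩
    rw [arrayTr, ← swapMap_image_cellSet]
    exact ⟨y, hy, rfl⟩

lemma arrayLink_arrayMirror (n : ℕ) (f : ℤ → ℤ → Tile) :
    arrayLink (arrayMirror n f) = mirrorMap (2 * ((n + 1 : ℤ) : ℝ)) '' arrayLink f := by
  ext x
  constructor
  · rintro ⟨i, j, hx⟩
    rw [arrayMirror, ← sub_sub_cancel ((n : ℤ) + 1) j, ← mirrorMap_image_cellSet,
      sub_sub_cancel] at hx
    obtain ⟨y, hy, rfl⟩ := hx
    exact ⟨y, ⟨_, _, hy⟩, rfl⟩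
  · rintro ⟨y, ⟨i, j, hy⟩, rfl⟩
    refine ⟨i, n + 1 - j, ?_⟩
    rw [arrayMirror, ← mirrorMap_image_cellSet, sub_sub_cancel]
    exact ⟨y, hy, rfl⟩

lemma arrayTr_arrayTr (f : ℤ → ℤ → Tile) : arrayTr (arrayTr f) = f := by
  funext i j; simp [arrayTr, Tile.tr_tr]

lemma arrayMirror_arrayMirror (n : ℕ) (f : ℤ → ℤ → Tile) :
    arrayMirror n (arrayMirror n f) = f := by
  funext i j; simp [arrayMirror, Tile.mirror_mirror]

lemma rankCount_comp {n k : ℕ} {f g : ℤ → ℤ → Tile} (φ : ℤ × ℤ → ℤ × ℤ)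
    (hφ : Function.Involutive φ) (hint : ∀ c ∈ interior n, φ c ∈ interior n)
    (h : ∀ c, (g c.1 c.2).rank = (f (φ c).1 (φ c).2).rank) : rankCount n k g = rankCount n k f := by
  refine Finset.card_nbij' φ φ ?_ ?_ (fun c _ => hφ c) (fun c _ => hφ c) <;>
    intro c hc <;> rw [Finset.mem_coe, Finset.mem_filter] at hc ⊢ <;> refine ⟨hint c hc.1, ?_⟩
  · rw [← h]; exact hc.2
  · rw [h, hφ]; exact hc.2

lemma rankCount_arrayTr (n k : ℕ) (f : ℤ → ℤ → Tile) :
    rankCount n k (arrayTr f) = rankCount n k f :=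
  rankCount_comp Prod.swap Prod.swap_swap
    (by rintro ⟨a, b⟩ h; rw [Prod.swap_prod_mk, mem_interior] at *; exact h.symm)
    fun c => Tile.rank_tr _

lemma rankCount_arrayMirror (n k : ℕ) (f : ℤ → ℤ → Tile) :
    rankCount n k (arrayMirror n f) = rankCount n k f :=
  rankCount_comp (fun c => (c.1, n + 1 - c.2)) (fun c => by simp)
    (by rintro ⟨a, b⟩ h; rw [mem_interior] at *; omega)
    fun c => Tile.rank_mirror _

lemma cost_arrayTr (n : ℕ) (f : ℤ → ℤ → Tile) : cost n (arrayTr f) = cost n f := by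
  simp only [cost, rankCount_arrayTr]

lemma cost_arrayMirror (n : ℕ) (f : ℤ → ℤ → Tile) : cost n (arrayMirror n f) = cost n f := by
  simp only [cost, rankCount_arrayMirror]

/-- The transpose of a mosaic. -/
def Mosaic.tr {n : ℕ} (M : Mosaic n) : Mosaic n where
  tile := arrayTr M.tile
  blank_outside i j h := by rw [arrayTr, M.blank_outside j i (by tauto)]; rfl

/-- The mirror image of a mosaic in the vertical axis. -/
def Mosaic.mirror {n : ℕ} (M : Mosaic n) : Mosaic n where
  tile := arrayMirror n M.tile
  blank_outside i j h := by rw [arrayMirror, M.blank_outside i _ (by omega)]; rfl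

/-- A reflection may change the knot type, but it carries triangle moves to triangle moves. Any
cheaper competitor of the reflected mosaic thus reflects back to one of the original. -/
lemma IsCheapest.tr {n : ℕ} {M : Mosaic n} (hM : IsCheapest M) : IsCheapest M.tr where
  connected := hM.connected.tr
  nonempty := by
    change (arrayLink (arrayTr M.tile)).Nonempty
    rw [arrayLink_arrayTr]; exact hM.nonempty.image _
  cost_le M' h1 h2 := by
    have h3 := h2.image swapMap swapMap_injective
    rw [← arrayLink_arrayTr, ← arrayLink_arrayTr] at h3
    have := hM.cost_le M'.tr h1.tr (by rwa [Mosaic.tr, arrayTr_arrayTr] at h3)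
    rw [Mosaic.tr, cost_arrayTr] at this
    rwa [Mosaic.tr, cost_arrayTr]

lemma IsCheapest.mirror {n : ℕ} {M : Mosaic n} (hM : IsCheapest M) : IsCheapest M.mirror where
  connected := hM.connected.mirror n
  nonempty := by
    change (arrayLink (arrayMirror n M.tile)).Nonempty
    rw [arrayLink_arrayMirror]; exact hM.nonempty.image _
  cost_le M' h1 h2 := by
    have h3 := h2.image (mirrorMap (2 * ((n + 1 : ℤ) : ℝ))) (mirrorMap_injective _)
    rw [← arrayLink_arrayMirror, ← arrayLink_arrayMirror] at h3
    have := hM.cost_le M'.mirror (h1.mirror n) (by rwa [Mosaic.mirror, arrayMirror_arrayMirror] at h3)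
    rw [Mosaic.mirror, cost_arrayMirror] at this
    rwa [Mosaic.mirror, cost_arrayMirror]


/-! ### Tiles determined by their used sides -/

lemma Mosaic.tr_tile {n : ℕ} (M : Mosaic n) (i j : ℤ) : M.tr.tile i j = (M.tile j i).tr := rfl

lemma Mosaic.mirror_tile {n : ℕ} (M : Mosaic n) (i j : ℤ) :
    M.mirror.tile i j = (M.tile i (n + 1 - j)).mirror := rfl

lemma Mosaic.tile_eq_of_row {n : ℕ} (M : Mosaic n) {i : ℤ} (j : ℤ) (h : i < 1 ∨ n < i) :
    M.tile i j = .I := M.blank_outside i j (by omega)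

lemma Mosaic.tile_eq_of_col {n : ℕ} (M : Mosaic n) (i : ℤ) {j : ℤ} (h : j < 1 ∨ n < j) :
    M.tile i j = .I := M.blank_outside i j (by omega)

lemma ArrayConnected.right_iff {f : ℤ → ℤ → Tile} (hf : ArrayConnected f) (i j : ℤ) :
    (f i j).Uses .right ↔ (f i (j + 1)).Uses .left := (hf i j).1

lemma ArrayConnected.top_iff {f : ℤ → ℤ → Tile} (hf : ArrayConnected f) (i j : ℤ) :
    (f i j).Uses .top ↔ (f (i + 1) j).Uses .bottom := (hf i j).2

lemma ArrayConnected.left_iff {f : ℤ → ℤ → Tile} (hf : ArrayConnected f) (i j : ℤ) :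
    (f i j).Uses .left ↔ (f i (j - 1)).Uses .right := by
  rw [hf.right_iff, sub_add_cancel]

lemma ArrayConnected.bottom_iff {f : ℤ → ℤ → Tile} (hf : ArrayConnected f) (i j : ℤ) :
    (f i j).Uses .bottom ↔ (f (i - 1) j).Uses .top := by
  rw [hf.top_iff, sub_add_cancel]

section determination

variable {t : Tile}

lemma Tile.not_uses_I (s : Side) : ¬ Tile.I.Uses s := by cases s <;> decide

/-- Strands have two ends and distinct ends use distinct sides, so the number of used sides is even;
three sides decide the fourth. -/
lemma Tile.even_uses (t : Tile) : ((t.Uses .left ↔ t.Uses .right) ↔ (t.Uses .bottom ↔ t.Uses .top)) := by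
  cases t <;> decide

lemma Tile.of_not_right_bottom (h1 : ¬ t.Uses .right) (h2 : ¬ t.Uses .bottom) :
    t = .I ∨ t = .IId := by revert h1 h2; cases t <;> decide

lemma Tile.of_not_right_top (h1 : ¬ t.Uses .right) (h2 : ¬ t.Uses .top) :
    t = .I ∨ t = .IIa := by revert h1 h2; cases t <;> decide

lemma Tile.of_not_left_top (h1 : ¬ t.Uses .left) (h2 : ¬ t.Uses .top) :
    t = .I ∨ t = .IIb := by revert h1 h2; cases t <;> decide

lemma Tile.of_not_left_bottom (h1 : ¬ t.Uses .left) (h2 : ¬ t.Uses .bottom) :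
    t = .I ∨ t = .IIc := by revert h1 h2; cases t <;> decide

lemma Tile.of_bottom_not_left (h1 : t.Uses .bottom) (h2 : ¬ t.Uses .left) :
    t = .IIIb ∨ t = .IIb := by revert h1 h2; cases t <;> decide

lemma Tile.of_top_not_left (h1 : t.Uses .top) (h2 : ¬ t.Uses .left) :
    t = .IIIb ∨ t = .IIc := by revert h1 h2; cases t <;> decide

lemma Tile.of_right_not_top (h1 : t.Uses .right) (h2 : ¬ t.Uses .top) :
    t = .IIIa ∨ t = .IIb := by revert h1 h2; cases t <;> decide

lemma Tile.of_left_top_not_bottom (h1 : t.Uses .left) (h2 : t.Uses .top) (h3 : ¬ t.Uses .bottom) :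
    t = .IId := by revert h1 h2 h3; cases t <;> decide

lemma Tile.of_left_top_not_right (h1 : t.Uses .left) (h2 : t.Uses .top) (h3 : ¬ t.Uses .right) :
    t = .IId := by revert h1 h2 h3; cases t <;> decide

lemma Tile.of_right_not_bottom_top (h1 : t.Uses .right) (h2 : ¬ t.Uses .bottom)
    (h3 : ¬ t.Uses .top) : t = .IIIa := by revert h1 h2 h3; cases t <;> decide

lemma Tile.of_left_right_not_bottom (h1 : t.Uses .left) (h2 : t.Uses .right)
    (h3 : ¬ t.Uses .bottom) : t = .IIIa := by revert h1 h2 h3; cases t <;> decide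

lemma Tile.isFull_of_left_bottom_top (h1 : t.Uses .left) (h2 : t.Uses .bottom) (h3 : t.Uses .top) :
    t.IsFull := by revert h1 h2 h3; unfold Tile.IsFull; cases t <;> decide

end determination

/-! ### Vertices with free sides -/

/-- No strand crosses any of the four cell sides that meet at the upper right corner of the cell
`(a, b)`. -/
structure OpenFace (f : ℤ → ℤ → Tile) (a b : ℤ) : Prop where
  below : ¬ (f a b).Uses .right
  left : ¬ (f a b).Uses .top
  above : ¬ (f (a + 1) b).Uses .right
  right : ¬ (f a (b + 1)).Uses .top

lemma OpenFace.tr {f : ℤ → ℤ → Tile} {a b : ℤ} (h : OpenFace f a b) :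
    OpenFace (arrayTr f) b a where
  below := by rw [arrayTr, (Tile.uses_tr _).2.2.1]; exact h.left
  left := by rw [arrayTr, (Tile.uses_tr _).2.2.2]; exact h.below
  above := by rw [arrayTr, (Tile.uses_tr _).2.2.1]; exact h.right
  right := by rw [arrayTr, (Tile.uses_tr _).2.2.2]; exact h.above

lemma OpenFace.mirror {f : ℤ → ℤ → Tile} {a b : ℤ} (h : OpenFace f a b) (hf : ArrayConnected f)
    (n : ℕ) : OpenFace (arrayMirror n f) a (n - b) := by
  have e1 : (n : ℤ) + 1 - (n - b) = b + 1 := by ring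
  have e2 : (n : ℤ) + 1 - (n - b + 1) = b := by ring
  constructor
  · rw [arrayMirror, (Tile.uses_mirror _).2.1, e1, ← hf.right_iff]; exact h.below
  · rw [arrayMirror, (Tile.uses_mirror _).2.2.2, e1]; exact h.right
  · rw [arrayMirror, (Tile.uses_mirror _).2.1, e1, ← hf.right_iff]; exact h.above
  · rw [arrayMirror, (Tile.uses_mirror _).2.2.2, e2]; exact h.left

namespace IsCheapest

variable {n : ℕ} {M : Mosaic n} {a b i j : ℤ}

/-- Around an open vertex the only alternative to a blank is an arc facing away from the vertex, and
that arc could be given a kink around it. Such an arc lies in S, since otherwise one of its ends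
would leave the board. -/
lemma lowerLeft_eq (hM : IsCheapest M) (h : OpenFace M.tile a b) (ha : a ≤ n - 1) (hb : b ≤ n - 1) :
    M.tile a b = .I := by
  have hc := hM.connected
  refine (Tile.of_not_right_top h.below h.left).resolve_right fun e => ?_
  refine hM.not_isKinkSite (i := a) (j := b) ⟨e, ?_, ?_, ?_⟩ (mem_interior.2 ?_)
  · exact Tile.of_not_left_top (by rw [← hc.right_iff]; exact h.below) h.right
  · exact Tile.of_not_right_bottom h.above (by rw [← hc.top_iff]; exact h.left)
  · exact Tile.of_not_left_bottom (by rw [← hc.right_iff]; exact h.above)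
      (by rw [← hc.top_iff]; exact h.right)
  · refine ⟨⟨?_, ha⟩, ?_, hb⟩
    · by_contra hlt
      have := (hc.bottom_iff a b).1 (by rw [e]; decide)
      rw [M.tile_eq_of_row _ (by omega)] at this
      exact Tile.not_uses_I _ this
    · by_contra hlt
      have := (hc.left_iff a b).1 (by rw [e]; decide)
      rw [M.tile_eq_of_col _ (by omega)] at this
      exact Tile.not_uses_I _ this

lemma lowerRight_eq (hM : IsCheapest M) (h : OpenFace M.tile a b) (ha : a ≤ n - 1) (hb : 1 ≤ b) :
    M.tile a (b + 1) = .I := by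
  have := hM.mirror.lowerLeft_eq (h.mirror hM.connected n) ha (by omega)
  change (M.tile a (n + 1 - (n - b))).mirror = .I at this
  rw [show (n : ℤ) + 1 - (n - b) = b + 1 by ring] at this
  rw [← Tile.mirror_mirror (M.tile a (b + 1)), this]; rfl

lemma upperLeft_eq (hM : IsCheapest M) (h : OpenFace M.tile a b) (ha : 1 ≤ a) (hb : b ≤ n - 1) :
    M.tile (a + 1) b = .I := by
  have := hM.tr.lowerRight_eq h.tr hb ha
  change (M.tile (a + 1) b).tr = .I at this
  rw [← Tile.tr_tr (M.tile (a + 1) b), this]; rfl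

lemma upperRight_eq (hM : IsCheapest M) (h : OpenFace M.tile a b) (ha : 1 ≤ a) (hb : 1 ≤ b) :
    M.tile (a + 1) (b + 1) = .I := by
  have := hM.mirror.upperLeft_eq (h.mirror hM.connected n) ha (by omega)
  change (M.tile (a + 1) (n + 1 - (n - b))).mirror = .I at this
  rw [show (n : ℤ) + 1 - (n - b) = b + 1 by ring] at this
  rw [← Tile.mirror_mirror (M.tile (a + 1) (b + 1)), this]; rfl

/-- If at most the right one of the cell sides meeting in a vertex is crossed by a strand, then none
is. -/
lemma openFace_of_left (hM : IsCheapest M) (ha : 1 ≤ a) (ha' : a ≤ n - 1) (hb : 1 ≤ b)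
    (hb' : b ≤ n - 1) (hint : (a, b) ∈ interior n ∨ (a + 1, b) ∈ interior n)
    (h1 : ¬ (M.tile a b).Uses .right) (h2 : ¬ (M.tile a b).Uses .top)
    (h3 : ¬ (M.tile (a + 1) b).Uses .right) : OpenFace M.tile a b := by
  refine ⟨h1, h2, h3, fun h4 => ?_⟩
  have hc := hM.connected
  have h5 : ¬ (M.tile a (b + 1)).Uses .left := by rwa [← hc.right_iff]
  have hne : ¬ M.tile a (b + 1) = .IId := fun e => h5 (by rw [e]; decide)
  refine hM.not_isStrip (j := b) (q := a) (i := a + 1) ⟨by omega, ?_, ?_, by omega, by omega,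
    Or.inl ⟨?_, ?_⟩⟩ ha (by omega) hb (by omega) (by omega) (hint.symm.imp_right fun h => ⟨h, hne⟩)
    fun e => absurd e hne
  · exact Tile.of_not_right_bottom h3 (by rwa [← hc.top_iff])
  · exact Tile.of_bottom_not_left (by rwa [← hc.top_iff]) (by rwa [← hc.right_iff])
  · exact Tile.of_not_right_top h1 h2
  · exact Tile.of_top_not_left h4 h5

/-- The two right-hand cells at an open vertex are blank, which frees three sides at the next
vertex; the fourth then follows. -/
lemma openFace_succ (hM : IsCheapest M) (h : OpenFace M.tile a b) (ha : 1 ≤ a) (ha' : a ≤ n - 1)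
    (hb : 1 ≤ b) (hb' : b + 1 ≤ n - 1) : OpenFace M.tile a (b + 1) := by
  have e1 := hM.lowerRight_eq h ha' hb
  have e2 := hM.upperRight_eq h ha hb
  refine hM.openFace_of_left ha ha' (by omega) hb' ?_ ?_ ?_ ?_
  · rw [mem_interior, mem_interior]; omega
  · rw [e1]; exact Tile.not_uses_I _
  · rw [e1]; exact Tile.not_uses_I _
  · rw [e2]; exact Tile.not_uses_I _

lemma openFace_right (hM : IsCheapest M) (h : OpenFace M.tile a b) (ha : 1 ≤ a) (ha' : a ≤ n - 1)
    (hb : 1 ≤ b) (j : ℤ) (hj : b ≤ j) : j ≤ n - 1 → OpenFace M.tile a j := by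
  induction j, hj using Int.leInduction with
  | base => exact fun _ => h
  | succ k hk ih =>
    exact fun hk' => hM.openFace_succ (ih (by omega)) ha ha' (by omega) hk'

lemma openFace_row (hM : IsCheapest M) (h : OpenFace M.tile a b) (ha : 1 ≤ a) (ha' : a ≤ n - 1)
    (hb : 1 ≤ b) (hb' : b ≤ n - 1) (j : ℤ) (hj : 1 ≤ j) (hj' : j ≤ n - 1) :
    OpenFace M.tile a j := by
  rcases le_total b j with hbj | hbj
  · exact hM.openFace_right h ha ha' hb j hbj hj'
  · have := (hM.mirror.openFace_right (h.mirror hM.connected n) ha ha' (by omega) (n - j)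
      (by omega) (by omega)).mirror hM.mirror.connected n
    rwa [Mosaic.mirror, arrayMirror_arrayMirror, sub_sub_cancel] at this

/-- Openness spreads along the row of the vertex and from there along every column. All tiles would
be blank and the link empty. -/
lemma not_openFace (hM : IsCheapest M) (ha : 1 ≤ a) (ha' : a ≤ n - 1) (hb : 1 ≤ b)
    (hb' : b ≤ n - 1) : ¬ OpenFace M.tile a b := by
  intro h
  have hall : ∀ i j : ℤ, 1 ≤ i → i ≤ n - 1 → 1 ≤ j → j ≤ n - 1 → OpenFace M.tile i j := by
    intro i j hi hi' hj hj'
    have h1 := hM.openFace_row h ha ha' hb hb' j hj hj'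
    have h2 := (hM.tr.openFace_row h1.tr hj hj' ha ha' i hi hi').tr
    rwa [Mosaic.tr, arrayTr_arrayTr] at h2
  have hblank : ∀ i j, M.tile i j = .I := by
    intro i j
    by_cases hij : (1 ≤ i ∧ i ≤ n) ∧ (1 ≤ j ∧ j ≤ n)
    swap
    · exact M.blank_outside i j hij
    obtain ⟨⟨hi, hi'⟩, hj, hj'⟩ := hij
    by_cases hin : i = n <;> by_cases hjn : j = n
    · have := hM.upperRight_eq (hall (i - 1) (j - 1) (by omega) (by omega) (by omega) (by omega))
        (by omega) (by omega)
      rwa [sub_add_cancel, sub_add_cancel] at this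
    · have := hM.upperLeft_eq (hall (i - 1) j (by omega) (by omega) (by omega) (by omega))
        (by omega) (by omega)
      rwa [sub_add_cancel] at this
    · have := hM.lowerRight_eq (hall i (j - 1) (by omega) (by omega) (by omega) (by omega))
        (by omega) (by omega)
      rwa [sub_add_cancel] at this
    · exact hM.lowerLeft_eq (hall i j (by omega) (by omega) (by omega) (by omega))
        (by omega) (by omega)
  obtain ⟨x, i, j, hx⟩ := hM.nonempty
  rw [hblank, cellSet_I] at hx
  exact hx

/-- This and its three reflected forms below exclude vertices with three free sides. -/
lemma not_open_left (hM : IsCheapest M) (ha : 1 ≤ a) (ha' : a ≤ n - 1) (hb : 1 ≤ b)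
    (hb' : b ≤ n - 1) (hint : (a, b) ∈ interior n ∨ (a + 1, b) ∈ interior n)
    (h1 : ¬ (M.tile a b).Uses .right) (h2 : ¬ (M.tile a b).Uses .top)
    (h3 : ¬ (M.tile (a + 1) b).Uses .right) : False :=
  hM.not_openFace ha ha' hb hb' (hM.openFace_of_left ha ha' hb hb' hint h1 h2 h3)

lemma not_open_right (hM : IsCheapest M) (ha : 1 ≤ a) (ha' : a ≤ n - 1) (hb : 1 ≤ b)
    (hb' : b ≤ n - 1) (hint : (a, b + 1) ∈ interior n ∨ (a + 1, b + 1) ∈ interior n)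
    (h1 : ¬ (M.tile a b).Uses .right) (h2 : ¬ (M.tile a (b + 1)).Uses .top)
    (h3 : ¬ (M.tile (a + 1) b).Uses .right) : False := by
  have e : (n : ℤ) + 1 - (n - b) = b + 1 := by ring
  refine hM.mirror.not_open_left (a := a) (b := n - b) ha ha' (by omega) (by omega) ?_ ?_ ?_ ?_
  · simp only [mem_interior] at *; omega
  · rwa [Mosaic.mirror_tile, (Tile.uses_mirror _).2.1, e, ← hM.connected.right_iff]
  · rwa [Mosaic.mirror_tile, (Tile.uses_mirror _).2.2.2, e]
  · rwa [Mosaic.mirror_tile, (Tile.uses_mirror _).2.1, e, ← hM.connected.right_iff]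

lemma not_open_below (hM : IsCheapest M) (ha : 1 ≤ a) (ha' : a ≤ n - 1) (hb : 1 ≤ b)
    (hb' : b ≤ n - 1) (hint : (a, b) ∈ interior n ∨ (a, b + 1) ∈ interior n)
    (h1 : ¬ (M.tile a b).Uses .right) (h2 : ¬ (M.tile a b).Uses .top)
    (h3 : ¬ (M.tile a (b + 1)).Uses .top) : False := by
  refine hM.tr.not_open_left (a := b) (b := a) hb hb' ha ha' ?_ ?_ ?_ ?_
  · simp only [mem_interior] at *; omega
  · rwa [Mosaic.tr_tile, (Tile.uses_tr _).2.2.1]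
  · rwa [Mosaic.tr_tile, (Tile.uses_tr _).2.2.2]
  · rwa [Mosaic.tr_tile, (Tile.uses_tr _).2.2.1]

lemma not_open_above (hM : IsCheapest M) (ha : 1 ≤ a) (ha' : a ≤ n - 1) (hb : 1 ≤ b)
    (hb' : b ≤ n - 1) (hint : (a + 1, b) ∈ interior n ∨ (a + 1, b + 1) ∈ interior n)
    (h1 : ¬ (M.tile (a + 1) b).Uses .right) (h2 : ¬ (M.tile a b).Uses .top)
    (h3 : ¬ (M.tile a (b + 1)).Uses .top) : False := by
  refine hM.tr.not_open_right (a := b) (b := a) hb hb' ha ha' ?_ ?_ ?_ ?_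
  · simp only [mem_interior] at *; omega
  · rwa [Mosaic.tr_tile, (Tile.uses_tr _).2.2.1]
  · rwa [Mosaic.tr_tile, (Tile.uses_tr _).2.2.2]
  · rwa [Mosaic.tr_tile, (Tile.uses_tr _).2.2.1]

end IsCheapest

/-! ### Brackets -/

/-- An arc of the dual that runs up column `j` from row `q` to row `i` and turns right there, and at
row `q` turns right or, if `q = 1`, leaves `S`. -/
structure IsBracket (f : ℤ → ℤ → Tile) (j q i : ℤ) : Prop where
  lt : q < i
  top : ∀ r, q ≤ r → r < i → ¬ (f r j).Uses .top
  turn : ¬ (f i j).Uses .right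
  right : ∀ r, q < r → r < i → (f r j).Uses .right
  start : q = 1 ∨ ¬ (f q j).Uses .right

namespace IsCheapest

variable {n : ℕ} {M : Mosaic n} {j q i : ℤ}

/-- Only the top two rows matter. Unless some vertex has three free sides, a strand leaves S at row
i - 1 and turns up in the boundary column n. It bounds a two-row strip whose turning tile, emptied
by the shift, is outside S. -/
lemma not_isBracket_last (hM : IsCheapest M) (h : IsBracket M.tile (n - 1) q i) (hn : (3 : ℤ) ≤ n)
    (hq : 1 ≤ q) (hi : i ≤ n - 1) : False := by
  have hlt := h.lt
  have hc := hM.connected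
  have htop := h.top (i - 1) (by omega) (by omega)
  have e : i - 1 + 1 = i := by ring
  have e' : (n : ℤ) - 1 + 1 = n := by ring
  have hint : (i - 1 + 1, (n : ℤ) - 1) ∈ interior n := by rw [mem_interior]; omega
  by_cases hS : (M.tile (i - 1) (n - 1)).Uses .right
  swap
  · exact hM.not_open_left (a := i - 1) (b := n - 1) (by omega) (by omega) (by omega) (by omega)
      (Or.inr hint) hS htop (by rw [e]; exact h.turn)
  by_cases hE : (M.tile (i - 1) n).Uses .top
  swap
  · exact hM.not_open_above (a := i - 1) (b := n - 1) (by omega) (by omega) (by omega) (by omega)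
      (Or.inl hint) (by rw [e]; exact h.turn) htop (by rwa [e'])
  have hR : ¬ (M.tile (i - 1) n).Uses .right := by
    rw [hc.right_iff, M.tile_eq_of_col _ (by omega)]
    exact Tile.not_uses_I _
  have hL : (M.tile (i - 1) n).Uses .left := by rwa [hc.left_iff]
  refine hM.not_isStrip (j := n - 1) (q := i - 1) (i := i) ⟨by omega, ?_, ?_, by omega, by omega,
    Or.inr ⟨?_, ?_⟩⟩ (by omega) (by omega) (by omega) (by omega) (by omega) (Or.inl ?_) ?_
  · exact Tile.of_not_right_bottom h.turn (by rwa [hc.bottom_iff])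
  · exact Tile.of_bottom_not_left (by rwa [hc.bottom_iff, e']) (by rw [← hc.right_iff]; exact h.turn)
  · exact Tile.of_right_not_top hS htop
  · rw [e']; exact Tile.of_left_top_not_right hL hE hR
  · rwa [e] at hint
  · intro _; rw [mem_interior]; omega

/-- The crossed sides in column j + 1 carry a vertical line of strands just right of the bracket,
and the bracket itself makes the left column of a strip. -/
lemma not_isBracket_of_forall (hM : IsCheapest M) (h : IsBracket M.tile j q i) (hj : 2 ≤ j)
    (hj' : j + 1 ≤ n - 1) (hq : 1 ≤ q) (hi : i ≤ n - 1)
    (hall : ∀ r, q ≤ r → r < i → (M.tile r (j + 1)).Uses .top) : False := by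
  have hlt := h.lt
  have hc := hM.connected
  have hbot : ∀ r, q < r → r ≤ i → ¬ (M.tile r j).Uses .bottom := fun r h1 h2 => by
    rw [hc.bottom_iff]; exact h.top _ (by omega) (by omega)
  have hbot' : ∀ r, q < r → r ≤ i → (M.tile r (j + 1)).Uses .bottom := fun r h1 h2 => by
    rw [hc.bottom_iff]; exact hall _ (by omega) (by omega)
  refine hM.not_isStrip (j := j) (q := q) (i := i) ⟨hlt, ?_, ?_, ?_, ?_, ?_⟩ hq (by omega)
    (by omega) (by omega) (fun _ => ⟨hj, hj'⟩) (Or.inl ?_) ?_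
  · exact Tile.of_not_right_bottom h.turn (hbot i hlt le_rfl)
  · exact Tile.of_bottom_not_left (hbot' i hlt le_rfl) (by rw [← hc.right_iff]; exact h.turn)
  · exact fun r h1 h2 => Tile.of_right_not_bottom_top (h.right r h1 h2) (hbot r h1 h2.le)
      (h.top r h1.le h2)
  · exact fun r h1 h2 => Tile.isFull_of_left_bottom_top
      (by rw [← hc.right_iff]; exact h.right r h1 h2) (hbot' r h1 h2.le) (hall r h1.le h2)
  -- If the right side is crossed, then q = 1. No strand enters the bottom row of the board from
  -- below, so the strand turns up there, outside S. Otherwise the strip ends without a turn.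
  · by_cases hR : (M.tile q j).Uses .right
    · have hq1 := h.start.resolve_right (not_not.2 hR)
      refine Or.inr ⟨Tile.of_right_not_top hR (h.top q le_rfl hlt), ?_⟩
      refine Tile.of_left_top_not_bottom (by rwa [← hc.right_iff]) (hall q le_rfl hlt) ?_
      rw [hc.bottom_iff, M.tile_eq_of_row _ (by omega)]
      exact Tile.not_uses_I _
    · exact Or.inl ⟨Tile.of_not_right_top hR (h.top q le_rfl hlt),
        Tile.of_top_not_left (hall q le_rfl hlt) (by rwa [← hc.right_iff])⟩
  · rw [mem_interior]; omega
  · intro e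
    have hR : (M.tile q j).Uses .right := by rw [hc.right_iff, e]; decide
    have hq1 := h.start.resolve_right (not_not.2 hR)
    rw [mem_interior]; omega

/-- If the column to the right of a bracket is not crossed by strands at every height, then that
column contains a bracket that ends in a lower row. -/
lemma exists_isBracket_succ (hM : IsCheapest M) (h : IsBracket M.tile j q i) (hj : 2 ≤ j)
    (hj' : j + 1 ≤ n - 1) (hq : 1 ≤ q) (hi : i ≤ n - 1)
    (hex : ∃ r, q ≤ r ∧ r < i ∧ ¬ (M.tile r (j + 1)).Uses .top) :
    ∃ a b, 1 ≤ a ∧ b < i ∧ IsBracket M.tile (j + 1) a b := by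
  have hlt := h.lt
  have hc := hM.connected
  -- The highest free side gives the new bracket its top: by maximality the arc cannot go on upwards
  -- from row m + 1, so parity makes it turn right there.
  obtain ⟨m, ⟨hqm, hmi, hm⟩, hmax⟩ := Int.exists_greatest_of_bdd
    (P := fun r => q ≤ r ∧ r < i ∧ ¬ (M.tile r (j + 1)).Uses .top) ⟨i, fun r hr => hr.2.1.le⟩ hex
  have hb : m + 1 < i := by
    by_contra hge
    obtain rfl : i = m + 1 := by omega
    exact hM.not_open_above (a := m) (b := j) (by omega) (by omega) (by omega) (by omega)
      (Or.inl (by rw [mem_interior]; omega)) h.turn (h.top m hqm (by omega)) hm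
  -- Row a is the first place, going down from m, where the right side is free or the bottom row of
  -- the board is reached.
  obtain ⟨a, ⟨ha1, ham, ha⟩, hamax⟩ := Int.exists_greatest_of_bdd
    (P := fun r => 1 ≤ r ∧ r ≤ m ∧ (r = 1 ∨ ¬ (M.tile r (j + 1)).Uses .right))
    ⟨m, fun r hr => hr.2.1⟩ ⟨1, le_rfl, by omega, Or.inl rfl⟩
  have hright : ∀ r, a < r → r ≤ m → (M.tile r (j + 1)).Uses .right := by
    intro r h1 h2
    by_contra hr
    have := hamax r ⟨by omega, h2, Or.inr hr⟩
    omega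
  -- While the left and right sides are crossed and the top is free, parity frees the bottom. The
  -- descent stays at or above row q: to pass it, q > 1 would be needed, and then the right turn of
  -- the old bracket gives a vertex with three free sides.
  have hdown : ∀ r, r ≤ m → a ≤ r → q ≤ r ∧ ¬ (M.tile r (j + 1)).Uses .top := by
    intro r hr
    induction r, hr using Int.leInductionDown with
    | base => exact fun _ => ⟨hqm, hm⟩
    | pred r hr ih =>
      intro har
      obtain ⟨hqr, hT⟩ := ih (by omega)
      have hR := hright r (by omega) hr
      rcases hqr.eq_or_lt with rfl | hqr
      · exact (hM.not_open_below (a := q) (b := j) (by omega) (by omega) (by omega) (by omega)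
          (Or.inl (by rw [mem_interior]; omega)) (h.start.resolve_left (by omega))
          (h.top q le_rfl hlt) hT).elim
      · refine ⟨by omega, ?_⟩
        rw [← hc.bottom_iff]
        have hL : (M.tile r (j + 1)).Uses .left := by
          rw [← hc.right_iff]; exact h.right r hqr (by omega)
        have := (M.tile r (j + 1)).even_uses
        tauto
  refine ⟨a, m + 1, ha1, hb, ⟨by omega, fun r h1 h2 => (hdown r (by omega) h1).2, ?_,
    fun r h1 h2 => hright r h1 (by omega), ha⟩⟩
  have hL : (M.tile (m + 1) (j + 1)).Uses .left := by
    rw [← hc.right_iff]; exact h.right _ (by omega) hb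
  have hB : ¬ (M.tile (m + 1) (j + 1)).Uses .bottom := by rwa [← hc.top_iff]
  have hT : (M.tile (m + 1) (j + 1)).Uses .top := by
    by_contra hT
    have := hmax (m + 1) ⟨by omega, hb, hT⟩
    omega
  have := (M.tile (m + 1) (j + 1)).even_uses
  tauto

/-- Each bracket is contradictory at once or produces one in the next column. The rows stay in range
because the new bracket ends lower, and the columns run out at n - 1. -/
lemma not_isBracket {n : ℕ} {M : Mosaic n} (hM : IsCheapest M) {j q i : ℤ}
    (h : IsBracket M.tile j q i) (hj : 2 ≤ j) (hj' : j ≤ n - 1) (hq : 1 ≤ q) (hi : i ≤ n - 1) :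
    False := by
  rcases hj'.eq_or_lt with rfl | hlt
  · exact hM.not_isBracket_last h (by omega) hq hi
  by_cases hall : ∀ r, q ≤ r → r < i → (M.tile r (j + 1)).Uses .top
  · exact hM.not_isBracket_of_forall h hj (by omega) hq hi hall
  push Not at hall
  obtain ⟨a, b, ha, hb, h'⟩ := hM.exists_isBracket_succ h hj (by omega) hq hi hall
  exact hM.not_isBracket h' (by omega) (by omega) ha (by omega)
termination_by (n - j).toNat

/-! ### Straight arcs and the boundary of S -/

/-- An arc of the dual that enters `S` from below does not turn right at its first turn. -/
lemma right_of_below (hM : IsCheapest M) (hj : 2 ≤ j) (hj' : j ≤ n - 1) (hi : 2 ≤ i)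
    (hi' : i ≤ n - 1) (h1 : ¬ (M.tile 1 j).Uses .top)
    (h : ∀ r, 2 ≤ r → r < i → M.tile r j = .IIIa) : (M.tile i j).Uses .right := by
  by_contra hR
  refine hM.not_isBracket (j := j) (q := 1) (i := i) ⟨by omega, fun r hr hr' => ?_, hR,
    fun r hr hr' => ?_, Or.inl rfl⟩ hj hj' le_rfl hi'
  · rcases hr.eq_or_lt with rfl | hr
    · exact h1
    · rw [h r (by omega) hr']; decide
  · rw [h r (by omega) hr']; decide

lemma left_of_below (hM : IsCheapest M) (hj : 2 ≤ j) (hj' : j ≤ n - 1) (hi : 2 ≤ i)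
    (hi' : i ≤ n - 1) (h1 : ¬ (M.tile 1 j).Uses .top)
    (h : ∀ r, 2 ≤ r → r < i → M.tile r j = .IIIa) : (M.tile i j).Uses .left := by
  have e : (n : ℤ) + 1 - (n + 1 - j) = j := by ring
  have := hM.mirror.right_of_below (j := n + 1 - j) (i := i) (by omega) (by omega) hi hi'
    (by rwa [Mosaic.mirror_tile, (Tile.uses_mirror _).2.2.2, e])
    (fun r h2 h3 => by rw [Mosaic.mirror_tile, e, h r h2 h3]; rfl)
  rwa [Mosaic.mirror_tile, (Tile.uses_mirror _).2.1, e] at this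

/-- An arc entering from below can turn neither way in any row, so the mosaic has horizontal
segments throughout the column: n - 2 tiles of positive rank. -/
lemma le_rankCount_of_not_top (hM : IsCheapest M) (hj : 2 ≤ j) (hj' : j ≤ n - 1)
    (h1 : ¬ (M.tile 1 j).Uses .top) : (n : ℤ) - 2 ≤ rankCount n 1 M.tile := by
  have key : ∀ i : ℤ, 2 ≤ i → i ≤ n - 1 → ∀ r : ℤ, 2 ≤ r → r ≤ i → M.tile r j = .IIIa := by
    intro i hi
    have step : ∀ i : ℤ, 2 ≤ i → i ≤ n - 1 → (∀ r, 2 ≤ r → r < i → M.tile r j = .IIIa) →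
        M.tile i j = .IIIa := by
      intro i hi hi' h
      refine Tile.of_left_right_not_bottom (hM.left_of_below hj hj' hi hi' h1 h)
        (hM.right_of_below hj hj' hi hi' h1 h) ?_
      rw [hM.connected.bottom_iff]
      rcases hi.eq_or_lt with rfl | hi
      · exact h1
      · rw [h (i - 1) (by omega) (by omega)]; decide
    induction i, hi using Int.leInduction with
    | base =>
      intro hn r h2 h3
      obtain rfl : r = 2 := by omega
      exact step 2 le_rfl hn fun r h4 h5 => by omega
    | succ k hk ih =>
      intro hn r h2 h3
      rcases h3.eq_or_lt with rfl | h3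
      · exact step _ h2 hn fun r h4 h5 => ih (by omega) r h4 (by omega)
      · exact ih (by omega) r h2 (by omega)
  have hsub : Finset.Icc (2 : ℤ) (n - 1) ×ˢ {j} ⊆
      ({c ∈ interior n | 1 ≤ (M.tile c.1 c.2).rank} : Finset (ℤ × ℤ)) := by
    rintro ⟨a, b⟩ hab
    rw [Finset.mem_product, Finset.mem_Icc, Finset.mem_singleton] at hab
    obtain ⟨⟨ha, ha'⟩, hb⟩ := hab
    simp only at ha ha' hb
    subst hb
    rw [Finset.mem_filter, mem_interior]
    refine ⟨⟨⟨ha, ha'⟩, hj, hj'⟩, ?_⟩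
    simp only
    rw [key a ha ha' a ha le_rfl]; decide
  have hcard := Finset.card_le_card hsub
  rw [Finset.card_product, Int.card_Icc, Finset.card_singleton, mul_one] at hcard
  unfold rankCount
  omega

lemma top_of_row_one (hM : IsCheapest M) (hsize : (rankCount n 1 M.tile : ℤ) ≤ n - 4) (hj : 2 ≤ j)
    (hj' : j ≤ n - 1) : (M.tile 1 j).Uses .top := by
  by_contra h
  have := hM.le_rankCount_of_not_top hj hj' h
  omega

lemma right_of_col_one (hM : IsCheapest M) (hsize : (rankCount n 1 M.tile : ℤ) ≤ n - 4)
    (hi : 2 ≤ i) (hi' : i ≤ n - 1) : (M.tile i 1).Uses .right := by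
  have := hM.tr.top_of_row_one (by rwa [Mosaic.tr, rankCount_arrayTr]) hi hi'
  rwa [Mosaic.tr_tile, (Tile.uses_tr _).2.2.2] at this

lemma right_of_col_pred (hM : IsCheapest M) (hsize : (rankCount n 1 M.tile : ℤ) ≤ n - 4)
    (hi : 2 ≤ i) (hi' : i ≤ n - 1) : (M.tile i (n - 1)).Uses .right := by
  have := hM.mirror.right_of_col_one (by rwa [Mosaic.mirror, rankCount_arrayMirror]) hi hi'
  rw [Mosaic.mirror_tile, (Tile.uses_mirror _).2.1, hM.connected.left_iff] at this
  rwa [show (n : ℤ) + 1 - 1 - 1 = n - 1 by ring] at this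

lemma top_of_row_pred (hM : IsCheapest M) (hsize : (rankCount n 1 M.tile : ℤ) ≤ n - 4)
    (hj : 2 ≤ j) (hj' : j ≤ n - 1) : (M.tile (n - 1) j).Uses .top := by
  have := hM.tr.right_of_col_pred (by rwa [Mosaic.tr, rankCount_arrayTr]) hj hj'
  rwa [Mosaic.tr_tile, (Tile.uses_tr _).2.2.1] at this

end IsCheapest

/-- This is the point of the replacement rule: a dual tile places its arcs on the sides its tile
leaves free. -/
lemma TileDual.uses_iff {R : Tile} {T : DualTile} (h : TileDual R T) (a : Side × Side)
    (ha : a ∈ T.arcs) : ¬ R.Uses a.1 ∧ ¬ R.Uses a.2 := by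
  revert a
  cases h <;> decide

/-- `SameComponent` is reflexive even at points carrying no arc; distinctness is what forces an arc
to end at p. -/
lemma DualArray.exists_arc {D : DualArray} {p q : ℤ × ℤ} (h : D.SameComponent p q) (hpq : p ≠ q) :
    ∃ i j : ℤ, ∃ a ∈ (D i j).arcs, p = sidePt i j a.1 ∨ p = sidePt i j a.2 := by
  have key : ∀ p q, D.SameComponent p q → p = q ∨
      ((∃ i j : ℤ, ∃ a ∈ (D i j).arcs, p = sidePt i j a.1 ∨ p = sidePt i j a.2) ∧
        ∃ i j : ℤ, ∃ a ∈ (D i j).arcs, q = sidePt i j a.1 ∨ q = sidePt i j a.2) := by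
    intro p q h
    induction h with
    | rel p q h =>
      obtain ⟨i, j, a, ha, hp, hq⟩ := h
      exact Or.inr ⟨⟨i, j, a, ha, Or.inl hp⟩, i, j, a, ha, Or.inr hq⟩
    | refl p => exact Or.inl rfl
    | symm p q _ ih => exact ih.imp Eq.symm And.symm
    | trans p q r _ _ ih1 ih2 =>
      rcases ih1 with rfl | ih1
      · exact ih2
      rcases ih2 with rfl | ih2
      · exact Or.inr ih1
      · exact Or.inr ⟨ih1.1, ih2.2⟩
  exact ((key p q h).resolve_left hpq).1

/-- A strand of the mosaic crosses every cell side on the boundary of `S`, so that no arc of the dual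
ends there. -/
lemma IsMinimalEmbedding.not_isEdge {n : ℕ} {M : Mosaic n} {D : DualArray}
    (h : IsMinimalEmbedding M D) (hD : (D.size n : ℤ) ≤ n - 4) (p q : ℤ × ℤ) :
    ¬ D.IsEdge n p q := by
  rintro ⟨hpq, ⟨X, hX⟩, -, hcomp⟩
  have hM := h.isCheapest
  have hc := hM.connected
  have hsize : (rankCount n 1 M.tile : ℤ) ≤ n - 4 := by
    have := congrArg (fun t => (ofLex t).1) h.isDual.triple_eq
    simp only [DualArray.triple, cost, ofLex_toLex] at this
    rwa [← this]
  obtain ⟨i, j, a, ha, hp⟩ := DualArray.exists_arc hcomp hpq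
  have hint : (i, j) ∈ interior n := by
    by_contra hint
    rw [(h.isDual i j).2 hint] at ha
    simp [DualTile.arcs] at ha
  obtain ⟨s, hs, rfl⟩ : ∃ s, ¬ (M.tile i j).Uses s ∧ p = sidePt i j s := by
    have := ((h.isDual i j).1 hint).uses_iff a ha
    rcases hp with hp | hp
    · exact ⟨_, this.1, hp⟩
    · exact ⟨_, this.2, hp⟩
  rw [mem_interior] at hint
  apply hs
  -- A midpoint on side X of S can be the midpoint of side s of a cell of S only for s = X; parity
  -- or the position of the cell rules out the rest.
  cases X <;> obtain ⟨k, hk, e⟩ := hX <;> rw [mem_interior] at hk <;> cases s <;>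
    simp only [sidePt, Prod.mk.injEq] at e <;> first | (exfalso; omega) | skip
  · obtain rfl : j = 2 := by omega
    rw [hc.left_iff]
    exact hM.right_of_col_one hsize hint.1.1 hint.1.2
  · obtain rfl : j = n - 1 := by omega
    exact hM.right_of_col_pred hsize hint.1.1 hint.1.2
  · obtain rfl : i = 2 := by omega
    rw [hc.bottom_iff]
    exact hM.top_of_row_one hsize hint.2.1 hint.2.2
  · obtain rfl : i = n - 1 := by omega
    exact hM.top_of_row_pred hsize hint.2.1 hint.2.2

end KnotMosaic

theorem theorem6p15 (n : ℕ) (M : KnotMosaic.Mosaic n) (D : KnotMosaic.DualArray)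
    (hMD : KnotMosaic.IsMinimalEmbedding M D) (hD : (D.size n : ℤ) ≤ (n : ℤ) - 4) :
    (¬ ∃ p q, D.IsXXEdge n p q) ∧ (¬ ∃ p q, D.IsXYEdge n p q) :=
  ⟨fun ⟨p, q, h⟩ => hMD.not_isEdge hD p q h.1, fun ⟨p, q, h⟩ => hMD.not_isEdge hD p q h.1⟩
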